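/- Throughout, "inaccessible" means uncountable, regular and strong limit, $V_\xi$ denotes the cumulative hierarchy, and $H_\kappa$ is the set of all sets whose transitive closure has cardinality $<\kappa$; $\Sigma_n$ and $\Pi_n$ refer to the Lévy hierarchy of formulas of set theory. A cardinal $\kappa$ is (lightface) $\Sigma^1_2$-indescribable if it is inaccessible and whenever $V_\kappa\vDash\exists X\,\forall Y\,\Phi(X,Y,p)$, where $\Phi$ is a first-order formula in the language of set theory with additional unary predicates $X$ and $Y$ (the second-order variables $X,Y$ range over all subsets of the structure) and $p\in V_\kappa$, there is an ordinal $\xi<\kappa$ with $p\in V_\xi$ and $V_\xi\vDash\exists X\,\forall Y\,\Phi(X,Y,p)$. A cardinal $\kappa$ is $\Sigma_n$-Mahlo if it is inaccessible and every closed unbounded subset of $\kappa$ that is definable over $\langle H_\kappa,\in\rangle$ by a $\Sigma_n$ formula with parameters from $H_\kappa$ contains an inaccessible cardinal. It is lightface $\Pi_n$-Mahlo if it is inaccessible and every closed unbounded subset of $\kappa$ that is definable over $\langle H_\kappa,\in\rangle$ by a $\Pi_n$ formula without parameters contains an inaccessible cardinal. **Fact.** (1) If $\kappa$ is lightface $\Sigma^1_2$-indescribable,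 then $\kappa$ is $\Sigma_2$-Mahlo; moreover, $\kappa$ is an inaccessible limit of $\Sigma_2$-Mahlo cardinals, i.e. $\kappa$ is inaccessible and the $\Sigma_2$-Mahlo cardinals below $\kappa$ are unbounded in $\kappa$. (2) If $\kappa$ is lightface $\Pi_2$-Mahlo, then $\kappa$ is an inaccessible limit of lightface $\Sigma^1_2$-indescribable cardinals, i.e. $\kappa$ is inaccessible and the $\Sigma^1_2$-indescribable cardinals below $\kappa$ are unbounded in $\kappa$. -/

import Mathlib

universe u v

namespace SetModel

open scoped ZFSet

/-! ### The first-order language of set theory and the Lévy hierarchy -/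

/-- The only relation symbol of the language of set theory: the binary symbol for membership. -/
inductive MemRel : ℕ → Type
  | mem : MemRel 2

/-- The first-order language of set theory (equality is part of the logic). -/
abbrev LSet : FirstOrder.Language.{0, 0} := ⟨fun _ => Empty, MemRel⟩

/-- The bounded quantification `∀ x ∈ t, φ x`, that is, the formula `∀ x, (x ∈ t → φ x)`.
The term `t` does not contain the quantified variable `x`. -/
def boundedAll {α : Type v} {n : ℕ} (t : LSet.Term (α ⊕ Fin n))
    (φ : LSet.BoundedFormula α (n + 1)) : LSet.BoundedFormula α n :=
  ((FirstOrder.Language.Relations.boundedFormula₂ (L := LSet) MemRel.mem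
      (FirstOrder.Language.Term.var (Sum.inr (Fin.last n)))
      (t.relabel (Sum.map id Fin.castSucc))).imp φ).all

/-- `Δ₀` formulas: those built from atomic formulas by propositional connectives and bounded
quantifiers. Falsum and implication generate all propositional connectives; the bounded
existential quantifier is `¬ ∀ x ∈ t, ¬ φ`. -/
inductive IsDelta0 {α : Type v} : ∀ {n : ℕ}, LSet.BoundedFormula α n → Prop
  | falsum {n : ℕ} : IsDelta0 (FirstOrder.Language.BoundedFormula.falsum : LSet.BoundedFormula α n)
  | atomic {n : ℕ} {φ : LSet.BoundedFormula α n} (h : φ.IsAtomic) : IsDelta0 φ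
  | imp {n : ℕ} {φ ψ : LSet.BoundedFormula α n} (hφ : IsDelta0 φ) (hψ : IsDelta0 ψ) :
      IsDelta0 (φ.imp ψ)
  | ball {n : ℕ} (t : LSet.Term (α ⊕ Fin n)) {φ : LSet.BoundedFormula α (n + 1)}
      (hφ : IsDelta0 φ) : IsDelta0 (boundedAll t φ)

/-- Formulas consisting of a (possibly empty) block of unbounded existential quantifiers in front
of a formula from the class `P`. -/
inductive ExBlock {α : Type v} (P : ∀ n : ℕ, LSet.BoundedFormula α n → Prop) :
    ∀ n : ℕ, LSet.BoundedFormula α n → Prop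
  | base {n : ℕ} {φ : LSet.BoundedFormula α n} (h : P n φ) : ExBlock P n φ
  | ex {n : ℕ} {φ : LSet.BoundedFormula α (n + 1)} (h : ExBlock P (n + 1) φ) : ExBlock P n φ.ex

/-- Formulas consisting of a (possibly empty) block of unbounded universal quantifiers in front
of a formula from the class `P`. -/
inductive AllBlock {α : Type v} (P : ∀ n : ℕ, LSet.BoundedFormula α n → Prop) :
    ∀ n : ℕ, LSet.BoundedFormula α n → Prop
  | base {n : ℕ} {φ : LSet.BoundedFormula α n} (h : P n φ) : AllBlock P n φ
  | all {n : ℕ} {φ : LSet.BoundedFormula α (n + 1)} (h : AllBlock P (n + 1) φ) :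
      AllBlock P n φ.all

/-- The Lévy hierarchy: level `0` consists of the `Δ₀` formulas; `LevyClass true (k + 1)` consists
of blocks of existential quantifiers followed by a formula from `LevyClass false k`, and
`LevyClass false (k + 1)` of blocks of universal quantifiers followed by a formula from
`LevyClass true k`. -/
def LevyClass {α : Type v} : Bool → ℕ → ∀ n : ℕ, LSet.BoundedFormula α n → Prop
  | _, 0 => fun _ φ => IsDelta0 φ
  | true, k + 1 => ExBlock (LevyClass false k)
  | false, k + 1 => AllBlock (LevyClass true k)

/-- The class `Σ_k` of the Lévy hierarchy: `Σ₀ = Δ₀`, and a `Σ_{k+1}` formula is a block of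
existential quantifiers followed by a `Π_k` formula. -/
def IsSigma {α : Type v} (k : ℕ) (φ : LSet.Formula α) : Prop := LevyClass true k 0 φ

/-- The class `Π_k` of the Lévy hierarchy: `Π₀ = Δ₀`, and a `Π_{k+1}` formula is a block of
universal quantifiers followed by a `Σ_k` formula. -/
def IsPi {α : Type v} (k : ℕ) (φ : LSet.Formula α) : Prop := LevyClass false k 0 φ

/-- The structure `⟨A, ∈⟩`, for a class `A` of sets. -/
@[reducible] def memStructure (A : Set ZFSet.{u}) : LSet.Structure A where
  funMap := fun f => Empty.elim f
  RelMap := fun r => match r with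
    | MemRel.mem => fun v => (v 0 : ZFSet.{u}) ∈ (v 1 : ZFSet.{u})

/-- `⟨A, ∈⟩ ⊨ φ[v]`. -/
def Sat (A : Set ZFSet.{u}) {α : Type v} (φ : LSet.Formula α) (v : α → A) : Prop :=
  @FirstOrder.Language.Formula.Realize LSet A (memStructure A) α φ v

/-! ### `Σ¹₂` statements over `V_ξ` -/

/-- The relation symbols of the language of set theory with two additional unary predicates. -/
inductive MemPredRel : ℕ → Type
  | mem : MemPredRel 2
  | predX : MemPredRel 1
  | predY : MemPredRel 1

/-- The language of set theory with two additional unary predicates `X` and `Y`. -/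
abbrev LSetXY : FirstOrder.Language.{0, 0} := ⟨fun _ => Empty, MemPredRel⟩

/-- The structure `⟨A, ∈, X, Y⟩`, for a class `A` of sets and `X, Y ⊆ A`. -/
@[reducible] def memPredStructure (A : Set ZFSet.{u}) (X Y : Set A) : LSetXY.Structure A where
  funMap := fun f => Empty.elim f
  RelMap := fun r => match r with
    | MemPredRel.mem => fun v => (v 0 : ZFSet.{u}) ∈ (v 1 : ZFSet.{u})
    | MemPredRel.predX => fun v => v 0 ∈ X
    | MemPredRel.predY => fun v => v 0 ∈ Y

/-- `A ⊨ ∃ X ∀ Y Φ(X, Y, p)`, where `Φ` is first-order with one free first-order variable, which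
is interpreted by `p`, and where `X` and `Y` range over all subsets of `A`. -/
def SatSigma12 (A : Set ZFSet.{u}) (Φ : LSetXY.Formula (Fin 1)) (p : A) : Prop :=
  ∃ X : Set A, ∀ Y : Set A,
    @FirstOrder.Language.Formula.Realize LSetXY A (memPredStructure A X Y) (Fin 1) Φ (fun _ => p)

/-- The rank-initial segment `V_ξ` of the universe, as a class. -/
def VSet (ξ : Ordinal.{u}) : Set ZFSet.{u} := {x | x ∈ V_ ξ}

/-- The `Σ¹₂` reflection property of a cardinal `κ`. -/
def HasSigma12Reflection (κ : Cardinal.{u}) : Prop :=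
  ∀ (Φ : LSetXY.Formula (Fin 1)) (p : ZFSet.{u}) (hp : p ∈ VSet κ.ord),
    SatSigma12 (VSet κ.ord) Φ ⟨p, hp⟩ →
      ∃ ξ : Ordinal.{u}, ξ < κ.ord ∧ ∃ hp' : p ∈ VSet ξ, SatSigma12 (VSet ξ) Φ ⟨p, hp'⟩

/-- (Lightface) `Σ¹₂`-indescribable cardinals. -/
def IsSigma12Indescribable (κ : Cardinal.{u}) : Prop :=
  κ.IsInaccessible ∧ HasSigma12Reflection κ

/-! ### Fragments of Mahloness -/

/-- The class `H_κ` of all sets `x` whose transitive closure has fewer than `κ` elements.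
The transitive closure is the least transitive set including `x`, so this means that
some transitive set including `x` has fewer than `κ` elements. -/
def HSet (κ : Cardinal.{u}) : Set ZFSet.{u} :=
  {x | ∃ t : ZFSet.{u}, t.IsTransitive ∧ x ⊆ t ∧ t.card < κ}

/-- The set `C` of ordinals below `κ` is defined in `H_κ` by the formula `φ` from the parameters
`p 0, …, p (m - 1) ∈ H_κ`; the first free variable of `φ` is the one for the elements of `C`,
which are taken as von Neumann ordinals. -/
def DefinesIn (κ : Cardinal.{u}) (C : Set (Set.Iio κ.ord)) {m : ℕ}
    (φ : LSet.Formula (Fin (m + 1))) (p : Fin m → HSet κ) : Prop :=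
  ∀ x : HSet κ, Sat (HSet κ) φ (Fin.cons x p) ↔
    ∃ ξ ∈ C, (x : ZFSet.{u}) = (ξ : Ordinal.{u}).toZFSet

/-- A set of ordinals below `κ` contains an inaccessible cardinal. -/
def ContainsInaccessible (κ : Cardinal.{u}) (C : Set (Set.Iio κ.ord)) : Prop :=
  ∃ ξ ∈ C, ∃ μ : Cardinal.{u}, μ.IsInaccessible ∧ (ξ : Ordinal.{u}) = μ.ord

/-- `Σ_n`-Mahlo cardinals (parameters from `H_κ` are allowed). -/
def IsSigmaMahlo (n : ℕ) (κ : Cardinal.{u}) : Prop :=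
  κ.IsInaccessible ∧ ∀ C : Set (Set.Iio κ.ord), IsClub C →
    (∃ (m : ℕ) (φ : LSet.Formula (Fin (m + 1))) (p : Fin m → HSet κ),
      IsSigma n φ ∧ DefinesIn κ C φ p) →
    ContainsInaccessible κ C

/-- Lightface `Π_n`-Mahlo cardinals (no parameters are allowed). -/
def IsLightfacePiMahlo (n : ℕ) (κ : Cardinal.{u}) : Prop :=
  κ.IsInaccessible ∧ ∀ C : Set (Set.Iio κ.ord), IsClub C →
    (∃ φ : LSet.Formula (Fin (0 + 1)), IsPi n φ ∧ DefinesIn κ C φ Fin.elim0) →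
    ContainsInaccessible κ C

/-- `κ` is an inaccessible limit of cardinals with the property `P`. -/
def IsInaccessibleLimitOf (P : Cardinal.{u} → Prop) (κ : Cardinal.{u}) : Prop :=
  κ.IsInaccessible ∧ ∀ μ < κ, ∃ ν : Cardinal.{u}, μ < ν ∧ ν < κ ∧ P ν

end SetModel

/-! Inaccessibility of `ν` is a `Π¹₁` property of `V_ν`: every class function from a member of `V_ν`
to `V_ν` is bounded in `V_ν` (`forall_inaccessibleWith_iff`). In `V_o`, `o > ν`, the classes
concerned are members, so the property becomes first-order. For a limit `o > ω`, a satisfaction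
class for `V_o` exists and is determined on codes of formulas (`isSatClass_trueSat`,
`IsSatClass.iff_eval`), so a second-order quantifier of either kind can introduce truth in `V_o`.
For inaccessible `κ`, moreover, `H_κ = V_κ`.

(1) Let a `Σ₂` formula `φ` define a club `C` in `V_κ`. The statement "the solutions of `φ` are
unbounded and the universe is inaccessible" is `Σ¹₂`, so it reflects to an inaccessible `ξ < κ`. By
Löwenheim-Skolem and collapsing, `Σ₂` formulas go up from `V_ξ` to `V_κ` (`LevyClass.bSat_up`).
Hence the solutions found in `V_ξ` are elements of `C`, `C` is unbounded in `ξ`, and `ξ ∈ C` because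
`C` is closed. Now `Σ₂`-Mahloness of `κ` can itself be written as a `Σ¹₂` statement: the existential
class is a satisfaction class, the universal one tests inaccessibility. Reflecting it, with a given
`μ₀ < κ` as a parameter, yields a `Σ₂`-Mahlo cardinal between `μ₀` and `κ`.

(2) Suppose that no cardinal strictly between `μ₀` and `κ` is indescribable. Call `ξ` a reflection
point if every `Σ¹₂` statement with parameters from levels below `ξ` that holds in some `V_a`, `a <
κ`, holds in some `V_c`, `c < ξ`, and if all reflecting inaccessibles below `κ` are below `ξ`. These
points form a club: close off `ω` times, starting above `μ₀` (`isClub_isReflectionPoint`). Being a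
reflection point can be checked in all limit levels `V_o` with `ξ < o < κ`; as "`W` is a level" is
`Π₁` modulo an existential witness, the club is `Π₂` (`exists_isPi_isReflectionPoint`), and `μ₀`
does not occur in its definition. So it has an inaccessible member `ξ`. The first clause with `a =
ξ` says that `ξ` is reflecting, and then the second says `ξ < ξ`. -/

namespace SetModel

/-! ### Relations uniformly definable over limit levels of the cumulative hierarchy -/

section

open scoped ZFSet
open FirstOrder FirstOrder.Language ZFSet

/-- A limit level `V_o` of the cumulative hierarchy with two unary predicates. -/
structure LevelStr : Type (u + 1) where
  o : Ordinal.{u}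
  X : ZFSet.{u} → Prop
  Y : ZFSet.{u} → Prop

/-- `⟨V_o, ∈, X, Y⟩ ⊨ φ[v]`. -/
def LevelStr.Sat (M : LevelStr.{u}) {α : Type} (φ : LSetXY.Formula α) (v : α → VSet M.o) : Prop :=
  @Formula.Realize LSetXY (VSet M.o)
    (memPredStructure (VSet M.o) {x | M.X x} {x | M.Y x}) α φ v

/-- The relation `R` is first-order definable, uniformly over all `⟨V_o, ∈, X, Y⟩` with `o` a
limit ordinal. -/
def Def {α : Type} (R : LevelStr.{u} → (α → ZFSet.{u}) → Prop) : Prop :=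
  ∃ φ : LSetXY.Formula α, ∀ M : LevelStr.{u}, Order.IsSuccLimit M.o → ∀ v : α → VSet M.o,
    M.Sat φ v ↔ R M fun a => v a

namespace Def

variable {α β : Type} {R R' : LevelStr.{u} → (α → ZFSet.{u}) → Prop}

theorem congr (h : Def R) (H : ∀ M : LevelStr.{u}, Order.IsSuccLimit M.o → ∀ v : α → ZFSet.{u},
    (∀ a, v a ∈ V_ M.o) → (R M v ↔ R' M v)) : Def R' := by
  obtain ⟨φ, hφ⟩ := h
  exact ⟨φ, fun M hM v => (hφ M hM v).trans (H M hM _ fun a => (v a).2)⟩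

theorem rename (h : Def R) (f : α → β) : Def fun M v => R M fun a => v (f a) := by
  obtain ⟨φ, hφ⟩ := h
  refine ⟨φ.relabel f, fun M hM v => ?_⟩
  let := memPredStructure (VSet M.o) {x | M.X x} {x | M.Y x}
  rw [LevelStr.Sat, Formula.realize_relabel]
  exact hφ M hM _

theorem false : Def fun (_ : LevelStr.{u}) (_ : α → ZFSet.{u}) => False :=
  ⟨⊥, fun _ _ _ => Iff.rfl⟩

theorem imp (h : Def R) (h' : Def R') : Def fun M v => R M v → R' M v := by
  obtain ⟨φ, hφ⟩ := h
  obtain ⟨ψ, hψ⟩ := h'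
  refine ⟨φ.imp ψ, fun M hM v => ?_⟩
  let := memPredStructure (VSet M.o) {x | M.X x} {x | M.Y x}
  rw [LevelStr.Sat, Formula.realize_imp]
  exact imp_congr (hφ M hM v) (hψ M hM v)

theorem not (h : Def R) : Def fun M v => ¬ R M v := h.imp .false

theorem and (h : Def R) (h' : Def R') : Def fun M v => R M v ∧ R' M v :=
  (h.imp h'.not).not.congr fun _ _ _ _ => by tauto

theorem or (h : Def R) (h' : Def R') : Def fun M v => R M v ∨ R' M v :=
  (h.not.imp h').congr fun _ _ _ _ => by tauto

theorem iff (h : Def R) (h' : Def R') : Def fun M v => R M v ↔ R' M v :=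
  ((h.imp h').and (h'.imp h)).congr fun _ _ _ _ => by tauto

theorem mem (i j : α) : Def fun (_ : LevelStr.{u}) (v : α → ZFSet.{u}) => v i ∈ v j := by
  refine ⟨Relations.formula₂ (L := LSetXY) MemPredRel.mem (Term.var i) (Term.var j),
    fun M hM v => ?_⟩
  let := memPredStructure (VSet M.o) {x | M.X x} {x | M.Y x}
  exact Formula.realize_rel₂ (L := LSetXY)

theorem eq (i j : α) : Def fun (_ : LevelStr.{u}) (v : α → ZFSet.{u}) => v i = v j := by
  refine ⟨Term.equal (L := LSetXY) (Term.var i) (Term.var j), fun M hM v => ?_⟩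
  let := memPredStructure (VSet M.o) {x | M.X x} {x | M.Y x}
  exact (Formula.realize_equal (L := LSetXY)).trans Subtype.ext_iff

theorem predX (i : α) : Def fun (M : LevelStr.{u}) (v : α → ZFSet.{u}) => M.X (v i) := by
  refine ⟨Relations.formula₁ (L := LSetXY) MemPredRel.predX (Term.var i), fun M hM v => ?_⟩
  let := memPredStructure (VSet M.o) {x | M.X x} {x | M.Y x}
  exact Formula.realize_rel₁ (L := LSetXY)

theorem predY (i : α) : Def fun (M : LevelStr.{u}) (v : α → ZFSet.{u}) => M.Y (v i) := by
  refine ⟨Relations.formula₁ (L := LSetXY) MemPredRel.predY (Term.var i), fun M hM v => ?_⟩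
  let := memPredStructure (VSet M.o) {x | M.X x} {x | M.Y x}
  exact Formula.realize_rel₁ (L := LSetXY)

/-- The point `none` of `Option α` is the bound variable. Keeping relations semantic in this way
lets definability of a compound notion be proved by following its syntax, without writing formulas.
-/
theorem all {R : LevelStr.{u} → (α → ZFSet.{u}) → ZFSet.{u} → Prop}
    (h : Def (α := Option α) fun M w => R M (fun a => w (some a)) (w none)) :
    Def fun M v => ∀ x ∈ V_ M.o, R M v x := by
  obtain ⟨φ, hφ⟩ := h
  let g : Option α → α ⊕ Fin 1 := fun o => o.elim (Sum.inr 0) Sum.inl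
  refine ⟨(BoundedFormula.relabel (n := 1) g φ).all, fun M hM v => ?_⟩
  let := memPredStructure (VSet M.o) {x | M.X x} {x | M.Y x}
  rw [LevelStr.Sat, Formula.Realize, BoundedFormula.realize_all]
  refine Iff.trans (b := ∀ a : VSet M.o, R M (fun i => v i) a) (forall_congr' fun a => ?_)
    Subtype.forall
  rw [BoundedFormula.realize_relabel]
  have := hφ M hM (fun o : Option α => o.elim a v)
  refine Iff.trans ?_ this
  rw [LevelStr.Sat, Formula.Realize]
  refine iff_of_eq ?_
  congr 1
  · funext o
    cases o with
    | none => rfl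
    | some b => rfl
  · exact Subsingleton.elim _ _

end Def

/-- The family of classes `S M v` is definable. -/
def DefP {α : Type} (S : LevelStr.{u} → (α → ZFSet.{u}) → ZFSet.{u} → Prop) : Prop :=
  Def (α := Option α) fun M w => S M (fun a => w (some a)) (w none)

variable {α β : Type} {D S : LevelStr.{u} → (α → ZFSet.{u}) → ZFSet.{u} → Prop}

/-- The classes `D M v` are included in the domain of `M`. -/
def InDom (D : LevelStr.{u} → (α → ZFSet.{u}) → ZFSet.{u} → Prop) : Prop :=
  ∀ M v x, (∀ a, v a ∈ V_ M.o) → D M v x → x ∈ V_ M.o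

theorem DefP.at (h : DefP S) (f : α → β) (k : β) :
    Def fun M v => S M (fun a => v (f a)) (v k) :=
  Def.rename h fun o : Option α => o.elim k f

theorem DefP.lift (h : DefP S) (f : α → β) : DefP fun M v => S M (fun a => v (f a)) :=
  h.at (fun a => some (f a)) none

namespace Def

variable {R : LevelStr.{u} → (α → ZFSet.{u}) → ZFSet.{u} → Prop}

theorem allIn (hD : DefP D) (hD' : InDom D)
    (h : Def (α := Option α) fun M w => R M (fun a => w (some a)) (w none)) :
    Def fun M v => ∀ x, D M v x → R M v x :=
  (Def.all (R := fun M v x => D M v x → R M v x) (Def.imp hD h)).congr fun M _ v hv =>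
    ⟨fun H x hx => H x (hD' M v x hv hx) hx, fun H x _ hx => H x hx⟩

theorem exIn (hD : DefP D) (hD' : InDom D)
    (h : Def (α := Option α) fun M w => R M (fun a => w (some a)) (w none)) :
    Def fun M v => ∃ x, D M v x ∧ R M v x :=
  (allIn (R := fun M v x => ¬ R M v x) hD hD' h.not).not.congr fun _ _ _ _ => by push Not; rfl

end Def

theorem DefP.memVar (i : α) : DefP fun (_ : LevelStr.{u}) v x => x ∈ v i :=
  Def.mem none (some i)

theorem InDom.memVar (i : α) : InDom fun (_ : LevelStr.{u}) v x => x ∈ v i :=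
  fun _ _ _ hv hx => (isTransitive_vonNeumann _).mem_trans hx (hv i)

/-- Inside the structure every element has this property, so a formula that always holds defines it.
-/
theorem DefP.dom : DefP fun (M : LevelStr.{u}) (_ : α → ZFSet.{u}) x => x ∈ V_ M.o :=
  (Def.false.not (α := Option α)).congr fun _ _ _ hv => ⟨fun _ => hv none, fun _ h => h⟩

theorem InDom.dom : InDom fun (M : LevelStr.{u}) (_ : α → ZFSet.{u}) x => x ∈ V_ M.o :=
  fun _ _ _ _ h => h

namespace Def

theorem ball {R : LevelStr.{u} → (α → ZFSet.{u}) → ZFSet.{u} → Prop} (i : α)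
    (h : Def (α := Option α) fun M w => R M (fun a => w (some a)) (w none)) :
    Def fun M v => ∀ x ∈ v i, R M v x :=
  allIn (.memVar i) (.memVar i) h

theorem bex {R : LevelStr.{u} → (α → ZFSet.{u}) → ZFSet.{u} → Prop} (i : α)
    (h : Def (α := Option α) fun M w => R M (fun a => w (some a)) (w none)) :
    Def fun M v => ∃ x ∈ v i, R M v x :=
  exIn (.memVar i) (.memVar i) h

theorem ex {R : LevelStr.{u} → (α → ZFSet.{u}) → ZFSet.{u} → Prop}
    (h : Def (α := Option α) fun M w => R M (fun a => w (some a)) (w none)) :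
    Def fun M v => ∃ x ∈ V_ M.o, R M v x :=
  exIn .dom .dom h

theorem subset (i j : α) : Def fun (_ : LevelStr.{u}) (v : α → ZFSet.{u}) => v i ⊆ v j :=
  ball i (.mem none (some j))

theorem eqPair₂ (i j k : α) :
    Def fun (_ : LevelStr.{u}) (v : α → ZFSet.{u}) => v i = {v j, v k} :=
  (all (R := fun _ v x => x ∈ v i ↔ x = v j ∨ x = v k)
    ((mem none (some i)).iff ((eq none (some j)).or (eq none (some k))))).congr fun M _ v hv => by
    refine ⟨fun H => ZFSet.ext fun x => ?_, fun H x _ => by rw [H, mem_pair]⟩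
    rw [mem_pair]
    constructor
    · exact fun hx => (H x ((isTransitive_vonNeumann _).mem_trans hx (hv i))).1 hx
    · rintro (rfl | rfl)
      exacts [(H _ (hv j)).2 (.inl rfl), (H _ (hv k)).2 (.inr rfl)]

end Def

theorem pair_mem_level {o : Ordinal.{u}} (ho : Order.IsSuccLimit o) {x y : ZFSet.{u}}
    (hx : x ∈ V_ o) (hy : y ∈ V_ o) : ({x, y} : ZFSet) ∈ V_ o := by
  rw [mem_vonNeumann] at *
  rw [rank_pair]
  exact max_lt (ho.succ_lt hx) (ho.succ_lt hy)

theorem opair_mem_level {o : Ordinal.{u}} (ho : Order.IsSuccLimit o) {x y : ZFSet.{u}} :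
    pair x y ∈ V_ o ↔ x ∈ V_ o ∧ y ∈ V_ o := by
  constructor
  · intro h
    have h2 : ({x, y} : ZFSet) ∈ V_ o :=
      (isTransitive_vonNeumann o).mem_trans (mem_pair.2 (.inr rfl)) h
    exact ⟨(isTransitive_vonNeumann o).mem_trans (mem_pair.2 (.inl rfl)) h2,
      (isTransitive_vonNeumann o).mem_trans (mem_pair.2 (.inr rfl)) h2⟩
  · rintro ⟨hx, hy⟩
    have := pair_mem_level ho (pair_mem_level ho hx hx) (pair_mem_level ho hx hy)
    rwa [pair_eq_singleton] at this

namespace Def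

theorem eqPair (i j k : α) :
    Def fun (_ : LevelStr.{u}) (v : α → ZFSet.{u}) => v i = pair (v j) (v k) :=
  (ex (R := fun _ v x => x = {v j, v j} ∧ ∃ y ∈ v i, y = {v j, v k} ∧ v i = {x, y})
    ((eqPair₂ none (some j) (some j)).and (bex (some i)
      ((eqPair₂ none (some (some j)) (some (some k))).and
        (eqPair₂ (some (some i)) (some none) none))))).congr fun M hM v hv => by
    constructor
    · rintro ⟨_, -, rfl, _, -, rfl, h⟩
      rw [h, pair, pair_eq_singleton]
    · intro h
      refine ⟨_, pair_mem_level hM (hv j) (hv j), rfl, _, ?_, rfl, ?_⟩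
      · rw [h]; exact mem_pair.2 (.inr rfl)
      · rw [h, pair, pair_eq_singleton]

/-- The pairing function is eliminated by an existential quantifier; the pair lies in the domain
because `o` is a limit. -/
theorem _root_.SetModel.DefP.pair (h : DefP S) (f : α → β) (i j : β) :
    Def fun M v => S M (fun a => v (f a)) (ZFSet.pair (v i) (v j)) :=
  (ex (R := fun M v x => x = ZFSet.pair (v i) (v j) ∧ S M (fun a => v (f a)) x)
    ((eqPair none (some i) (some j)).and (h.at _ none))).congr fun M hM v hv => by
    constructor
    · rintro ⟨_, -, rfl, h⟩
      exact h
    · exact fun h => ⟨_, (opair_mem_level hM).2 ⟨hv i, hv j⟩, rfl, h⟩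

theorem pair_mem (i j k : α) :
    Def fun (_ : LevelStr.{u}) (v : α → ZFSet.{u}) => pair (v i) (v j) ∈ v k :=
  (DefP.memVar k).pair id i j

theorem eqEmpty (i : α) : Def fun (_ : LevelStr.{u}) (v : α → ZFSet.{u}) => v i = ∅ :=
  (ball i (R := fun _ _ _ => False) .false).congr fun _ _ _ _ => (eq_empty _).symm

theorem isTransitive (i : α) :
    Def fun (_ : LevelStr.{u}) (v : α → ZFSet.{u}) => (v i).IsTransitive :=
  ball i (subset none (some i))

theorem isOrdinal (i : α) :
    Def fun (_ : LevelStr.{u}) (v : α → ZFSet.{u}) => (v i).IsOrdinal :=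
  ((isTransitive i).and (ball i (R := fun _ _ x => x.IsTransitive) (isTransitive none))).congr
    fun _ _ _ _ => isOrdinal_iff_forall_mem_isTransitive.symm

end Def

end

/-! ### Inaccessibility as a second-order property of a level; `H_κ = V_κ` -/

section

open scoped ZFSet
open ZFSet Ordinal Cardinal

/-- Every class function in `Y` from a set in `D` to `D` is bounded by a set in `D`. -/
def IsBoundedOn (D Y : ZFSet.{u} → Prop) : Prop :=
  ∀ x, D x → (∀ z ∈ x, ∀ y, D y → ∀ y', D y' → Y (pair z y) → Y (pair z y') → y = y') →
    ∃ b, D b ∧ ∀ z ∈ x, ∀ y, D y → Y (pair z y) → y ∈ b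

/-- Every set in `D` is a member of a set in `D`. -/
def IsLimitDom (D : ZFSet.{u} → Prop) : Prop := ∀ x, D x → ∃ y, D y ∧ x ∈ y

/-- `D` contains a nonempty set without an `∈`-maximal element. -/
def HasInfiniteSet (D : ZFSet.{u} → Prop) : Prop :=
  ∃ x, D x ∧ ¬ x = ∅ ∧ ∀ y ∈ x, ∃ z ∈ x, y ∈ z

/-- For `D = V_ν` and all `Y` this says that `ν` is inaccessible. -/
def InaccessibleWith (D Y : ZFSet.{u} → Prop) : Prop :=
  IsLimitDom D ∧ HasInfiniteSet D ∧ IsBoundedOn D Y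

theorem isSuccLimit_of_isLimitDom {ν : Ordinal.{u}} (h : IsLimitDom (· ∈ V_ ν))
    (h0 : ∃ x, x ∈ V_ ν) : Order.IsSuccLimit ν := by
  refine ⟨?_, ?_⟩
  · obtain ⟨x, hx⟩ := h0
    rw [mem_vonNeumann] at hx
    exact fun hν => not_lt_of_ge (isMin_iff_eq_bot.1 hν ▸ bot_le) hx
  · rw [Order.isSuccPrelimit_iff_succ_lt]
    intro a ha
    obtain ⟨y, hy, hay⟩ := h (V_ a) (vonNeumann_mem_of_lt ha)
    have := rank_lt_of_mem hay
    rw [rank_vonNeumann] at this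
    exact (Order.succ_le_of_lt this).trans_lt (mem_vonNeumann.1 hy)

theorem isLimitDom_vonNeumann {ν : Ordinal.{u}} (h : Order.IsSuccLimit ν) :
    IsLimitDom (· ∈ V_ ν) := fun x hx =>
  ⟨{x, x}, pair_mem_level h hx hx, mem_pair.2 (.inl rfl)⟩

/-- Ranks increase strictly along an endless `∈`-chain of elements of `x`, so `x` has rank at least
`ω`. -/
theorem omega0_lt_of_hasInfiniteSet {ν : Ordinal.{u}} (h : HasInfiniteSet (· ∈ V_ ν)) : ω < ν := by
  obtain ⟨x, hx, h0, hs⟩ := h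
  rw [mem_vonNeumann] at hx
  refine lt_of_le_of_lt ?_ hx
  rw [omega0_le]
  intro n
  suffices ∃ y ∈ x, (n : Ordinal) ≤ rank y by
    obtain ⟨y, hy, hn⟩ := this
    exact hn.trans (rank_lt_of_mem hy).le
  induction n with
  | zero =>
    obtain ⟨y, hy⟩ := not_forall_not.1 fun h => h0 ((eq_empty x).2 h)
    exact ⟨y, hy, by simp⟩
  | succ n ih =>
    obtain ⟨y, hy, hn⟩ := ih
    obtain ⟨z, hz, hyz⟩ := hs y hy
    refine ⟨z, hz, ?_⟩
    push_cast
    exact Order.add_one_le_of_lt (hn.trans_lt (rank_lt_of_mem hyz))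

theorem hasInfiniteSet_vonNeumann {ν : Ordinal.{u}} (h : ω < ν) : HasInfiniteSet (· ∈ V_ ν) := by
  refine ⟨(ω : Ordinal.{u}).toZFSet, by simpa [mem_vonNeumann], fun h0 => ?_, fun y hy => ?_⟩
  · have : (0 : Ordinal).toZFSet ∈ (ω : Ordinal.{u}).toZFSet := toZFSet_mem_toZFSet_iff.2 omega0_pos
    rw [h0] at this
    exact notMem_empty _ this
  · obtain ⟨a, ha, rfl⟩ := mem_toZFSet_iff.1 hy
    exact ⟨(a + 1).toZFSet, toZFSet_mem_toZFSet_iff.2 (isSuccLimit_omega0.succ_lt ha),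
      toZFSet_mem_toZFSet_iff.2 (lt_add_one a)⟩

theorem card_lt_of_mem_vonNeumann {μ : Cardinal.{u}} (hμ : μ.IsInaccessible) {x : ZFSet.{u}}
    (hx : x ∈ V_ μ.ord) : x.card < μ := by
  rw [mem_vonNeumann] at hx
  refine (card_mono (subset_vonNeumann_self x)).trans_lt ?_
  rw [card_vonNeumann, ← hμ.preBeth_ord]
  exact preBeth_strictMono hx

theorem exists_bound_of_card_lt {μ : Cardinal.{u}} (hμ : μ.IsInaccessible) {x : ZFSet.{u}}
    (hx : x.card < μ) (g : ZFSet.{u} → Ordinal.{u}) (hg : ∀ z ∈ x, g z < μ.ord) :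
    ∃ β < μ.ord, ∀ z ∈ x, g z < β := by
  refine ⟨⨆ z : Shrink x, Order.succ (g ((equivShrink x).symm z)), ?_, fun z hz => ?_⟩
  · refine iSup_lt_of_lt_cof ?_ fun z => ?_
    · rw [hμ.isRegular.cof_ord]
      exact hx
    · exact (isSuccLimit_ord hμ.aleph0_lt.le).succ_lt (hg _ ((equivShrink x).symm z).2)
  · rw [Ordinal.lt_iSup_iff]
    exact ⟨equivShrink x ⟨z, hz⟩, by simp⟩

theorem isBoundedOn_of_isInaccessible {μ : Cardinal.{u}} (hμ : μ.IsInaccessible)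
    (Y : ZFSet.{u} → Prop) : IsBoundedOn (· ∈ V_ μ.ord) Y := by
  intro x hx hY
  classical
  -- The rank of the value at `z`, and the harmless `0` where the function is undefined.
  let g : ZFSet.{u} → Ordinal.{u} := fun z =>
    if h : ∃ y ∈ V_ μ.ord, Y (pair z y) then rank h.choose else 0
  have hpos : (0 : Ordinal.{u}) < μ.ord := (isSuccLimit_ord hμ.aleph0_lt.le).bot_lt
  obtain ⟨β, hβ, hb⟩ := exists_bound_of_card_lt hμ (card_lt_of_mem_vonNeumann hμ hx) g (by
    intro z _
    by_cases h : ∃ y ∈ V_ μ.ord, Y (pair z y)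
    · simp only [g, dif_pos h]
      exact mem_vonNeumann.1 h.choose_spec.1
    · simp only [g, dif_neg h, hpos])
  refine ⟨V_ β, vonNeumann_mem_of_lt hβ, fun z hz y hy hzy => ?_⟩
  have h : ∃ y ∈ V_ μ.ord, Y (pair z y) := ⟨y, hy, hzy⟩
  have := hb z hz
  simp only [g, dif_pos h] at this
  rw [hY z hz y hy _ h.choose_spec.1 hzy h.choose_spec.2]
  exact mem_vonNeumann.2 this

theorem inaccessibleWith_of_isInaccessible {μ : Cardinal.{u}} (hμ : μ.IsInaccessible)
    (Y : ZFSet.{u} → Prop) : InaccessibleWith (· ∈ V_ μ.ord) Y :=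
  ⟨isLimitDom_vonNeumann (isSuccLimit_ord hμ.aleph0_lt.le),
    hasInfiniteSet_vonNeumann (by simpa using ord_strictMono hμ.aleph0_lt),
    isBoundedOn_of_isInaccessible hμ Y⟩

/-- Boundedness of class functions on the members of `V_ν` rules out cofinal sets of small size.
Tested on an ordinal of size `cof ν` it gives regularity, and on power sets the strong limit
property. -/
theorem exists_isInaccessible {ν : Ordinal.{u}}
    (h : ∀ Y, InaccessibleWith (· ∈ V_ ν) Y) : ∃ μ : Cardinal.{u}, μ.IsInaccessible ∧ ν = μ.ord := by
  have hω : ω < ν := omega0_lt_of_hasInfiniteSet (h fun _ => True).2.1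
  have hlim : Order.IsSuccLimit ν := isSuccLimit_of_isLimitDom (h fun _ => True).1
    ⟨∅, by simpa [mem_vonNeumann] using hω.bot_lt⟩
  -- The inverse of an injection of a cofinal `s` into `x` is a class function on a subset of `x`; a
  -- bound for it in `V_ν` would bound `s`.
  have key : ∀ x ∈ V_ ν, ∀ s : Set Ordinal.{u}, (∀ a ∈ s, a < ν) → (∀ b < ν, ∃ a ∈ s, b ≤ a) →
      ¬ #s ≤ #x := by
    rintro x hx s hs hcof ⟨f⟩
    obtain ⟨b, hb, hxb⟩ := (h fun z => ∃ a : s, z = pair (f a) (a : Ordinal).toZFSet).2.2 x hx (by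
      rintro z - y - y' - ⟨a, ha⟩ ⟨a', ha'⟩
      rw [pair_inj] at ha ha'
      have : a = a' := f.injective (Subtype.ext (ha.1.symm.trans ha'.1))
      rw [ha.2, ha'.2, this])
    obtain ⟨a, ha, hba⟩ := hcof (rank b) (mem_vonNeumann.1 hb)
    have := hxb _ (f ⟨a, ha⟩).2 a.toZFSet (by simpa [mem_vonNeumann] using hs a ha)
      ⟨⟨a, ha⟩, rfl⟩
    have := rank_lt_of_mem this
    rw [rank_toZFSet] at this
    exact this.not_ge hba
  have hc : ν.cof.ord = ν := by
    refine (ord_cof_le ν).eq_of_not_lt fun hlt => ?_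
    obtain ⟨s, hs, hs'⟩ := Order.exists_cof_eq (Set.Iio ν)
    refine key ν.cof.ord.toZFSet (by simpa [mem_vonNeumann] using hlt) (Subtype.val '' s) ?_ ?_ ?_
    · rintro _ ⟨a, -, rfl⟩
      exact a.2
    · intro b hb
      obtain ⟨a, ha, hba⟩ := hs ⟨b, hb⟩
      exact ⟨a, ⟨a, ha, rfl⟩, hba⟩
    · rw [mk_image_eq Subtype.val_injective, hs', cardinalMk_coe_sort, card_toZFSet, card_ord,
        Ordinal.cof_Iio, Ordinal.lift_cof]
  refine ⟨ν.cof, ⟨?_, by rw [hc], ?_⟩, hc.symm⟩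
  · rw [← ord_lt_ord, hc, ord_aleph0]
    exact hω
  · intro c hcν
    by_contra! hle
    have hcν' : c.ord < ν := by rw [← hc]; exact ord_strictMono hcν
    -- If `ν ≤ 2 ^ c`, then all of `ν` injects into the power set of `c`, which lies in `V_ν` as `ν`
    -- is a limit.
    refine key (powerset c.ord.toZFSet) ?_ (Set.Iio ν) (fun _ => id) (fun b hb => ⟨b, hb, le_rfl⟩) ?_
    · rw [mem_vonNeumann, rank_powerset, rank_toZFSet]
      exact hlim.succ_lt hcν'
    · rw [cardinalMk_coe_sort, Cardinal.mk_Iio_ordinal, Cardinal.lift_le, card_powerset, card_toZFSet, card_ord]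
      refine le_trans ?_ hle
      conv_lhs => rw [← hc, card_ord]

theorem forall_inaccessibleWith_iff {ν : Ordinal.{u}} :
    (∀ Y, InaccessibleWith (· ∈ V_ ν) Y) ↔ ∃ μ : Cardinal.{u}, μ.IsInaccessible ∧ ν = μ.ord :=
  ⟨exists_isInaccessible, by
    rintro ⟨μ, hμ, rfl⟩
    exact inaccessibleWith_of_isInaccessible hμ⟩

/-- Quantification over subsets of `V_ν` can be bounded by any larger level. -/
theorem forall_mem_inaccessibleWith_iff {ν o : Ordinal.{u}} (hν : ν < o) :
    (∀ Y ∈ V_ o, InaccessibleWith (· ∈ V_ ν) (· ∈ Y)) ↔ ∀ Y, InaccessibleWith (· ∈ V_ ν) Y := by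
  refine ⟨fun h Y => ?_, fun h Y _ => h _⟩
  have hl := (h ∅ (by simpa [mem_vonNeumann] using hν.bot_lt)).1
  have hi := (h ∅ (by simpa [mem_vonNeumann] using hν.bot_lt)).2.1
  have hlim := isSuccLimit_of_isLimitDom hl (let ⟨x, hx, _⟩ := hi; ⟨x, hx⟩)
  refine ⟨hl, hi, fun x hx hY => ?_⟩
  -- Only pairs of elements of `V_ν` matter, so `Y` may be replaced by its trace on `V_ν`, a member
  -- of `V_o`.
  have := (h ((V_ ν).sep Y) (mem_vonNeumann_of_subset sep_subset (vonNeumann_mem_of_lt hν))).2.2 x hx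
  have hz : ∀ z ∈ x, z ∈ V_ ν := fun z hz => (isTransitive_vonNeumann _).mem_trans hz hx
  simp only [ZFSet.mem_sep, opair_mem_level hlim] at this
  obtain ⟨b, hb, hb'⟩ := this fun z hz y hy y' hy' h h' => hY z hz y hy y' hy' h.2 h'.2
  exact ⟨b, hb, fun z hzx y hy hzy => hb' z hzx y hy ⟨⟨hz z hzx, hy⟩, hzy⟩⟩

/-- In a transitive set of size `< κ` all ranks are below `κ`, by `∈`-induction and regularity.
Conversely `V_a` for `a < κ` is a transitive set of size `< κ`, since `κ` is a strong limit. -/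
theorem hSet_eq_vSet {κ : Cardinal.{u}} (hκ : κ.IsInaccessible) : HSet κ = VSet κ.ord := by
  ext x
  constructor
  · rintro ⟨t, ht, hxt, hc⟩
    refine mem_vonNeumann_of_subset hxt (?_ : t ∈ V_ κ.ord)
    have hmem : ∀ z, z ∈ t → z.rank < κ.ord := by
      intro z
      induction z using ZFSet.inductionOn with
      | _ z ih =>
        intro hz
        have hzt := ht z hz
        obtain ⟨β, hβ, hb⟩ := exists_bound_of_card_lt hκ ((card_mono hzt).trans_lt hc) rank
          fun y hy => ih y hy (hzt hy)
        exact (rank_le_iff.2 hb).trans_lt hβ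
    obtain ⟨β, hβ, hb⟩ := exists_bound_of_card_lt hκ hc rank hmem
    exact mem_vonNeumann.2 ((rank_le_iff.2 hb).trans_lt hβ)
  · intro hx
    have hx' : x.rank < κ.ord := mem_vonNeumann.1 hx
    exact ⟨V_ x.rank, isTransitive_vonNeumann _, subset_vonNeumann_self x,
      card_lt_of_mem_vonNeumann hκ (vonNeumann_mem_of_lt hx')⟩

section Definability

variable {α : Type} {D Y : LevelStr.{u} → (α → ZFSet.{u}) → ZFSet.{u} → Prop}

theorem InDom.lift {β : Type} (h : InDom D) (f : α → β) : InDom fun M v => D M fun a => v (f a) :=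
  fun M v x hv hx => h M (fun a => v (f a)) x (fun a => hv (f a)) hx

theorem Def.isLimitDom (hD : DefP D) (hD' : InDom D) : Def fun M v => IsLimitDom (D M v) :=
  .allIn hD hD' (.exIn (hD.lift some) (hD'.lift some) (.mem (some none) none))

theorem Def.hasInfiniteSet (hD : DefP D) (hD' : InDom D) : Def fun M v => HasInfiniteSet (D M v) :=
  .exIn hD hD' (.and (.not (.eqEmpty none)) (.ball none (.bex (some none) (.mem (some none) none))))

theorem Def.isBoundedOn (hD : DefP D) (hD' : InDom D) (hY : DefP Y) :
    Def fun M v => IsBoundedOn (D M v) (Y M v) := by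
  refine .allIn hD hD' (.imp (.ball none ?_) (.exIn (hD.lift _) (hD'.lift _) (.ball (some none) ?_)))
  · refine .allIn (hD.lift _) (hD'.lift _) (.allIn (hD.lift _) (hD'.lift _) ?_)
    exact .imp (hY.pair _ _ _) (.imp (hY.pair _ _ _) (.eq _ _))
  · exact .allIn (hD.lift _) (hD'.lift _) (.imp (hY.pair _ _ _) (.mem _ _))

theorem Def.inaccessibleWith (hD : DefP D) (hD' : InDom D) (hY : DefP Y) :
    Def fun M v => InaccessibleWith (D M v) (Y M v) :=
  (isLimitDom hD hD').and ((hasInfiniteSet hD hD').and (isBoundedOn hD hD' hY))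

end Definability

end

/-! ### Coded formulas, assignments and satisfaction classes -/

section

open scoped ZFSet
open ZFSet Ordinal

/-! ### Assignments -/

/-- The union of all `y` with `(i, y) ∈ s`. -/
noncomputable def app (s i : ZFSet.{u}) : ZFSet.{u} :=
  (⋃₀ (⋃₀ (⋃₀ s : ZFSet) : ZFSet) : ZFSet).sep fun z => ∃ y, pair i y ∈ s ∧ z ∈ y

theorem mem_app {s i z : ZFSet.{u}} : z ∈ app s i ↔ ∃ y, pair i y ∈ s ∧ z ∈ y := by
  refine ⟨fun h => (ZFSet.mem_sep.1 h).2, fun h => ZFSet.mem_sep.2 ⟨?_, h⟩⟩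
  obtain ⟨y, hy, hz⟩ := h
  have h1 : ({i, y} : ZFSet) ∈ (⋃₀ s : ZFSet) := mem_sUnion.2 ⟨_, hy, mem_pair.2 (.inr rfl)⟩
  exact mem_sUnion.2 ⟨y, mem_sUnion.2 ⟨_, h1, mem_pair.2 (.inr rfl)⟩, hz⟩

/-- Every set counts as an assignment, functional or not; this makes its values at all arguments lie
in the level. -/
theorem app_mem_level {o : Ordinal.{u}} {s : ZFSet.{u}} (hs : s ∈ V_ o) (i : ZFSet.{u}) :
    app s i ∈ V_ o := by
  rw [mem_vonNeumann] at *
  refine (rank_mono sep_subset).trans_lt (lt_of_le_of_lt ?_ hs)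
  exact (rank_sUnion_le _).trans ((rank_sUnion_le _).trans (rank_sUnion_le _))

/-- `s` and `t` have the same values in `D` at all arguments in `D` other than `n`. -/
def AgreeOff (D : ZFSet.{u} → Prop) (n s t : ZFSet.{u}) : Prop :=
  ∀ j, D j → ¬ j = n → ∀ y, D y → (pair j y ∈ s ↔ pair j y ∈ t)

theorem AgreeOff.app_eq {o : Ordinal.{u}} (ho : Order.IsSuccLimit o) {n s t j : ZFSet.{u}}
    (h : AgreeOff (· ∈ V_ o) n s t) (hs : s ∈ V_ o) (ht : t ∈ V_ o) (hj : j ∈ V_ o) (hjn : j ≠ n) :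
    app t j = app s j := by
  have h' : ∀ r ∈ V_ o, ∀ y, pair j y ∈ r → y ∈ V_ o := fun r hr y hy =>
    ((opair_mem_level ho).1 ((isTransitive_vonNeumann _).mem_trans hy hr)).2
  ext z
  rw [mem_app, mem_app]
  constructor
  · rintro ⟨y, hy, hz⟩
    exact ⟨y, (h j hj hjn y (h' t ht y hy)).2 hy, hz⟩
  · rintro ⟨y, hy, hz⟩
    exact ⟨y, (h j hj hjn y (h' s hs y hy)).1 hy, hz⟩

theorem exists_agreeOff {o : Ordinal.{u}} (ho : Order.IsSuccLimit o) {n s x : ZFSet.{u}}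
    (hs : s ∈ V_ o) (hn : n ∈ V_ o) (hx : x ∈ V_ o) :
    ∃ t ∈ V_ o, AgreeOff (· ∈ V_ o) n s t ∧ app t n = x := by
  have hp : pair n x ∈ V_ o := (opair_mem_level ho).2 ⟨hn, hx⟩
  -- All pairs with first entry `n` are discarded from `s`, so that `x` is the only value left at
  -- `n`.
  refine ⟨insert (pair n x) (s.sep fun p => ∀ y, p ≠ pair n y), ?_, ?_, ?_⟩
  · rw [mem_vonNeumann] at *
    rw [rank_insert]
    exact max_lt (ho.succ_lt hp) ((rank_mono sep_subset).trans_lt hs)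
  · intro j _ hj y _
    simp [hj, ZFSet.mem_sep]
  · ext z
    rw [mem_app]
    simp [ZFSet.mem_sep]

/-! ### Formulas with named variables -/

/-- First-order formulas over membership and two unary predicates, with natural numbers as
variables. -/
inductive NFormula : Type
  | eq (i j : ℕ)
  | mem (i j : ℕ)
  | predX (i : ℕ)
  | predY (i : ℕ)
  | nand (p q : NFormula)
  | all (n : ℕ) (q : NFormula)

namespace NFormula

/-- Satisfaction in `⟨A, ∈, X, Y⟩`. -/
def Eval (A X Y : ZFSet.{u} → Prop) : NFormula → (ℕ → ZFSet.{u}) → Prop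
  | eq i j, g => g i = g j
  | mem i j, g => g i ∈ g j
  | predX i, g => X (g i)
  | predY i, g => Y (g i)
  | nand p q, g => ¬ (p.Eval A X Y g ∧ q.Eval A X Y g)
  | all n q, g => ∀ x, A x → q.Eval A X Y (Function.update g n x)

/-- An injective numbering of formulas. -/
def enc : NFormula → ℕ
  | eq i j => Nat.pair 0 (Nat.pair i j)
  | mem i j => Nat.pair 1 (Nat.pair i j)
  | predX i => Nat.pair 2 i
  | predY i => Nat.pair 3 i
  | nand p q => Nat.pair 4 (Nat.pair p.enc q.enc)
  | all n q => Nat.pair 5 (Nat.pair n q.enc)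

theorem enc_injective : Function.Injective enc := by
  intro p
  induction p with
  | nand p q ihp ihq =>
    intro r h
    cases r <;> simp [enc] at h
    rw [ihp h.1, ihq h.2]
  | all n q ih =>
    intro r h
    cases r <;> simp [enc] at h
    rw [h.1, ih h.2]
  | _ =>
    intro r h
    cases r <;> simp_all [enc]

end NFormula

/-- The natural number `n` as a set. -/
noncomputable def natSet (n : ℕ) : ZFSet.{u} := (n : Ordinal.{u}).toZFSet

theorem natSet_injective : Function.Injective natSet.{u} := fun _ _ h => by
  simpa using toZFSet_injective h

@[simp]
theorem natSet_inj {m n : ℕ} : natSet.{u} m = natSet n ↔ m = n := natSet_injective.eq_iff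

theorem natSet_zero : natSet.{u} 0 = ∅ := by simp [natSet]

theorem natSet_mem_omega (n : ℕ) : natSet.{u} n ∈ V_ ω := by
  simp [natSet, mem_vonNeumann]

theorem natSet_mem_level {o : Ordinal.{u}} (ho : ω < o) (n : ℕ) : natSet.{u} n ∈ V_ o :=
  vonNeumann_subset_of_le ho.le (natSet_mem_omega n)

namespace NFormula

/-- The formula `q` as a set. -/
noncomputable def code (q : NFormula) : ZFSet.{u} := natSet q.enc

@[simp]
theorem code_inj {p q : NFormula} : code.{u} p = code q ↔ p = q :=
  natSet_inj.trans enc_injective.eq_iff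

theorem code_mem_level {o : Ordinal.{u}} (ho : ω < o) (q : NFormula) : code.{u} q ∈ V_ o :=
  natSet_mem_level ho _

end NFormula

open NFormula

/-- The graphs of the constructors of `NFormula`, in terms of codes. -/
noncomputable def codeTable : Fin 6 → ZFSet.{u} :=
  ![range fun p : ℕ × ℕ => pair (code (.eq p.1 p.2)) (pair (natSet p.1) (natSet p.2)),
    range fun p : ℕ × ℕ => pair (code (.mem p.1 p.2)) (pair (natSet p.1) (natSet p.2)),
    range fun i : ℕ => pair (code (.predX i)) (natSet i),
    range fun i : ℕ => pair (code (.predY i)) (natSet i),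
    range fun p : NFormula × NFormula => pair (code (.nand p.1 p.2)) (pair (code p.1) (code p.2)),
    range fun p : ℕ × NFormula => pair (code (.all p.1 p.2)) (pair (natSet p.1) (code p.2))]

/-- The tables are subsets of `V_ω`. Being available as parameters, they spare a definition of the
syntax inside the structure. -/
theorem codeTable_mem_level {o : Ordinal.{u}} (ho : ω < o) (k : Fin 6) :
    codeTable.{u} k ∈ V_ o := by
  refine mem_vonNeumann.2 (lt_of_le_of_lt ?_ ho)
  rw [← subset_vonNeumann]
  have hp : ∀ {x y : ZFSet.{u}}, x ∈ V_ ω → y ∈ V_ ω → pair x y ∈ V_ ω :=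
    fun hx hy => (opair_mem_level isSuccLimit_omega0).2 ⟨hx, hy⟩
  have hn := natSet_mem_omega.{u}
  intro x hx
  fin_cases k <;> simp only [codeTable, Fin.reduceFinMk, Matrix.cons_val, Fin.zero_eta, Fin.mk_one,
      Matrix.cons_val_zero, Matrix.cons_val_one, mem_range] at hx <;> obtain ⟨p, rfl⟩ := hx
  · exact hp (hn _) (hp (hn _) (hn _))
  · exact hp (hn _) (hp (hn _) (hn _))
  · exact hp (hn _) (hn _)
  · exact hp (hn _) (hn _)
  · exact hp (hn _) (hp (hn _) (hn _))
  · exact hp (hn _) (hp (hn _) (hn _))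

/-! ### Satisfaction classes -/

/-- `S` is a satisfaction class for the structure `⟨D, ∈, X, Y⟩` and the formulas described by the
tables `T`; its elements are pairs of a code and an assignment. -/
structure IsSatClass (D S X Y : ZFSet.{u} → Prop) (T : Fin 6 → ZFSet.{u}) : Prop where
  eq : ∀ c, D c → ∀ i, D i → ∀ j, D j → pair c (pair i j) ∈ T 0 → ∀ s, D s →
    (S (pair c s) ↔ ∃ a, D a ∧ a = app s i ∧ a = app s j)
  mem : ∀ c, D c → ∀ i, D i → ∀ j, D j → pair c (pair i j) ∈ T 1 → ∀ s, D s →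
    (S (pair c s) ↔ ∃ a, D a ∧ a = app s i ∧ ∃ b, D b ∧ b = app s j ∧ a ∈ b)
  predX : ∀ c, D c → ∀ i, D i → pair c i ∈ T 2 → ∀ s, D s →
    (S (pair c s) ↔ ∃ a, D a ∧ a = app s i ∧ X a)
  predY : ∀ c, D c → ∀ i, D i → pair c i ∈ T 3 → ∀ s, D s →
    (S (pair c s) ↔ ∃ a, D a ∧ a = app s i ∧ Y a)
  nand : ∀ c, D c → ∀ d, D d → ∀ e, D e → pair c (pair d e) ∈ T 4 → ∀ s, D s →
    (S (pair c s) ↔ ¬ (S (pair d s) ∧ S (pair e s)))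
  all : ∀ c, D c → ∀ n, D n → ∀ d, D d → pair c (pair n d) ∈ T 5 → ∀ s, D s →
    (S (pair c s) ↔ ∀ t, D t → AgreeOff D n s t → S (pair d t))

/-- The values of the variables under the assignment `s`. -/
noncomputable def values (s : ZFSet.{u}) (n : ℕ) : ZFSet.{u} := app s (natSet n)

section

variable {o : Ordinal.{u}} (ho : Order.IsSuccLimit o) (hω : ω < o)
include ho hω

theorem values_of_agreeOff {s t : ZFSet.{u}} {n : ℕ} (hs : s ∈ V_ o) (ht : t ∈ V_ o)
    (h : AgreeOff (· ∈ V_ o) (natSet n) s t) :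
    values t = Function.update (values s) n (values t n) := by
  funext m
  by_cases hm : m = n
  · subst hm; simp
  · rw [Function.update_of_ne hm]
    exact h.app_eq ho hs ht (natSet_mem_level hω m) (by simpa using hm)

theorem exists_values_update {s x : ZFSet.{u}} (n : ℕ) (hs : s ∈ V_ o) (hx : x ∈ V_ o) :
    ∃ t ∈ V_ o, AgreeOff (· ∈ V_ o) (natSet n) s t ∧
      values t = Function.update (values s) n x := by
  obtain ⟨t, ht, hst, htx⟩ := exists_agreeOff ho hs (natSet_mem_level hω n) hx
  refine ⟨t, ht, hst, ?_⟩
  rw [values_of_agreeOff ho hω hs ht hst]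
  exact congrArg _ htx

/-- Changing an assignment at `n` realizes exactly the updates of its values by elements of the
level, so the quantifier clause of a satisfaction class has its intended meaning. -/
theorem forall_agreeOff_iff {s : ZFSet.{u}} (n : ℕ) (hs : s ∈ V_ o) {P : (ℕ → ZFSet.{u}) → Prop} :
    (∀ t, t ∈ V_ o → AgreeOff (· ∈ V_ o) (natSet n) s t → P (values t)) ↔
      ∀ x, x ∈ V_ o → P (Function.update (values s) n x) := by
  constructor
  · intro h x hx
    obtain ⟨t, ht, hst, htv⟩ := exists_values_update ho hω n hs hx
    exact htv ▸ h t ht hst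
  · intro h t ht hst
    rw [values_of_agreeOff ho hω hs ht hst]
    exact h _ (app_mem_level ht _)

theorem exists_values_eq {m : ℕ} (g : Fin m → ZFSet.{u}) (hg : ∀ i, g i ∈ V_ o) :
    ∃ s ∈ V_ o, ∀ i : Fin m, values s i = g i := by
  induction m with
  | zero => exact ⟨∅, by simpa [mem_vonNeumann] using hω.bot_lt, fun i => i.elim0⟩
  | succ m ih =>
    obtain ⟨s, hs, hsg⟩ := ih (fun i => g i.castSucc) fun i => hg _
    obtain ⟨t, ht, -, htv⟩ := exists_values_update ho hω m hs (hg (Fin.last m))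
    refine ⟨t, ht, fun i => ?_⟩
    rw [htv]
    refine Fin.lastCases ?_ (fun j => ?_) i
    · simp
    · rw [Function.update_of_ne (by simpa using j.2.ne)]
      exact hsg j

/-- Induction on the formula: the clauses are Tarski's. Satisfaction classes thus agree on codes,
and it makes no difference whether "some" or "every" satisfaction class is consulted. -/
theorem IsSatClass.iff_eval {S X Y : ZFSet.{u} → Prop}
    (h : IsSatClass (· ∈ V_ o) S X Y codeTable) (q : NFormula) {s : ZFSet.{u}} (hs : s ∈ V_ o) :
    S (pair q.code s) ↔ q.Eval (· ∈ V_ o) X Y (values s) := by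
  have hn := natSet_mem_level.{u} hω
  have hc := code_mem_level.{u} hω
  induction q generalizing s with
  | eq i j =>
    rw [h.eq _ (hc _) _ (hn i) _ (hn j) (mem_range.2 ⟨(i, j), rfl⟩) s hs]
    exact ⟨fun ⟨a, _, h1, h2⟩ => h1.symm.trans h2, fun H => ⟨_, app_mem_level hs _, rfl, H⟩⟩
  | mem i j =>
    rw [h.mem _ (hc _) _ (hn i) _ (hn j) (mem_range.2 ⟨(i, j), rfl⟩) s hs]
    constructor
    · rintro ⟨_, _, rfl, _, _, rfl, H⟩
      exact H
    · exact fun H => ⟨_, app_mem_level hs _, rfl, _, app_mem_level hs _, rfl, H⟩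
  | predX i =>
    rw [h.predX _ (hc _) _ (hn i) (mem_range.2 ⟨i, rfl⟩) s hs]
    constructor
    · rintro ⟨_, _, rfl, H⟩
      exact H
    · exact fun H => ⟨_, app_mem_level hs _, rfl, H⟩
  | predY i =>
    rw [h.predY _ (hc _) _ (hn i) (mem_range.2 ⟨i, rfl⟩) s hs]
    constructor
    · rintro ⟨_, _, rfl, H⟩
      exact H
    · exact fun H => ⟨_, app_mem_level hs _, rfl, H⟩
  | nand p q ihp ihq =>
    rw [h.nand _ (hc _) _ (hc p) _ (hc q) (mem_range.2 ⟨(p, q), rfl⟩) s hs]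
    exact not_congr (and_congr (ihp hs) (ihq hs))
  | all n q ih =>
    rw [h.all _ (hc _) _ (hn n) _ (hc q) (mem_range.2 ⟨(n, q), rfl⟩) s hs]
    refine Iff.trans ?_ (forall_agreeOff_iff ho hω n hs)
    exact forall_congr' fun t => forall_congr' fun ht => forall_congr' fun _ => ih ht

end

/-- The satisfaction class of `⟨A, ∈, X, Y⟩`. -/
def trueSat (A X Y : ZFSet.{u} → Prop) (z : ZFSet.{u}) : Prop :=
  ∃ (q : NFormula) (s : ZFSet.{u}), z = pair q.code s ∧ q.Eval A X Y (values s)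

theorem trueSat_pair {A X Y : ZFSet.{u} → Prop} {q : NFormula} {s : ZFSet.{u}} :
    trueSat A X Y (pair q.code s) ↔ q.Eval A X Y (values s) := by
  constructor
  · rintro ⟨q', s', h, h'⟩
    rw [pair_inj, code_inj] at h
    rwa [h.1, h.2]
  · exact fun h => ⟨q, s, rfl, h⟩

theorem isSatClass_trueSat {o : Ordinal.{u}} (ho : Order.IsSuccLimit o) (hω : ω < o)
    (X Y : ZFSet.{u} → Prop) :
    IsSatClass (· ∈ V_ o) (trueSat (· ∈ V_ o) X Y) X Y codeTable := by
  constructor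
  · rintro c - i - j - h s hs
    obtain ⟨⟨i, j⟩, h⟩ := mem_range.1 h
    simp only [pair_inj] at h
    obtain ⟨rfl, rfl, rfl⟩ := h
    rw [trueSat_pair]
    exact ⟨fun H => ⟨_, app_mem_level hs _, rfl, H⟩, fun ⟨a, _, h1, h2⟩ => h1.symm.trans h2⟩
  · rintro c - i - j - h s hs
    obtain ⟨⟨i, j⟩, h⟩ := mem_range.1 h
    simp only [pair_inj] at h
    obtain ⟨rfl, rfl, rfl⟩ := h
    rw [trueSat_pair]
    constructor
    · exact fun H => ⟨_, app_mem_level hs _, rfl, _, app_mem_level hs _, rfl, H⟩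
    · rintro ⟨_, _, rfl, _, _, rfl, H⟩
      exact H
  · rintro c - i - h s hs
    obtain ⟨i, h⟩ := mem_range.1 h
    simp only [pair_inj] at h
    obtain ⟨rfl, rfl⟩ := h
    rw [trueSat_pair]
    constructor
    · exact fun H => ⟨_, app_mem_level hs _, rfl, H⟩
    · rintro ⟨_, _, rfl, H⟩
      exact H
  · rintro c - i - h s hs
    obtain ⟨i, h⟩ := mem_range.1 h
    simp only [pair_inj] at h
    obtain ⟨rfl, rfl⟩ := h
    rw [trueSat_pair]
    constructor
    · exact fun H => ⟨_, app_mem_level hs _, rfl, H⟩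
    · rintro ⟨_, _, rfl, H⟩
      exact H
  · rintro c - d - e - h s hs
    obtain ⟨⟨p, q⟩, h⟩ := mem_range.1 h
    simp only [pair_inj] at h
    obtain ⟨rfl, rfl, rfl⟩ := h
    rw [trueSat_pair, trueSat_pair, trueSat_pair]
    rfl
  · rintro c - n - d - h s hs
    obtain ⟨⟨n, q⟩, h⟩ := mem_range.1 h
    simp only [pair_inj] at h
    obtain ⟨rfl, rfl, rfl⟩ := h
    simp only [trueSat_pair]
    exact (forall_agreeOff_iff ho hω n hs).symm

/-! ### Definability -/

section Definability

variable {α : Type} {D S X Y : LevelStr.{u} → (α → ZFSet.{u}) → ZFSet.{u} → Prop}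

theorem Def.eqApp (i j k : α) :
    Def fun (_ : LevelStr.{u}) (v : α → ZFSet.{u}) => v i = app (v j) (v k) :=
  (Def.and (R := fun M v => ∀ z ∈ v i, ∃ y ∈ V_ M.o, pair (v k) y ∈ v j ∧ z ∈ y)
    (R' := fun M v => ∀ y ∈ V_ M.o, pair (v k) y ∈ v j → ∀ z ∈ y, z ∈ v i)
    (.ball _ (.ex (.and (.pair_mem _ _ _) (.mem _ _))))
    (.all (.imp (.pair_mem _ _ _) (.ball _ (.mem _ _))))).congr fun M hM v hv => by
    -- By transitivity the values recorded in `v j` lie in the domain, so the quantifier over `y`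
    -- may be restricted to it.
    have hy : ∀ {y}, pair (v k) y ∈ v j → y ∈ V_ M.o := fun {y} hy =>
      ((opair_mem_level hM).1 ((isTransitive_vonNeumann _).mem_trans hy (hv j))).2
    rw [ZFSet.ext_iff]
    simp only [mem_app]
    constructor
    · rintro ⟨h1, h2⟩ z
      exact ⟨fun hz => let ⟨y, _, h⟩ := h1 z hz; ⟨y, h⟩, fun ⟨y, h, h'⟩ => h2 y (hy h) h z h'⟩
    · intro h
      exact ⟨fun z hz => let ⟨y, h1, h2⟩ := (h z).1 hz; ⟨y, hy h1, h1, h2⟩,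
        fun y _ h1 z hz => (h z).2 ⟨y, h1, hz⟩⟩

theorem Def.agreeOff (hD : DefP D) (hD' : InDom D) (i j k : α) :
    Def fun M v => AgreeOff (D M v) (v i) (v j) (v k) :=
  .allIn hD hD' (.imp (.not (.eq _ _)) (.allIn (hD.lift _) (hD'.lift _)
    (.iff (.pair_mem _ _ _) (.pair_mem _ _ _))))

theorem Def.tripleMem (i j k l : α) :
    Def fun (_ : LevelStr.{u}) (v : α → ZFSet.{u}) => pair (v i) (pair (v j) (v k)) ∈ v l :=
  (ex (R := fun _ v x => x = pair (v j) (v k) ∧ pair (v i) x ∈ v l)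
    (.and (.eqPair _ _ _) (.pair_mem _ _ _))).congr fun M hM v hv => by
    constructor
    · rintro ⟨_, -, rfl, h⟩
      exact h
    · exact fun h => ⟨_, (opair_mem_level hM).2 ⟨hv j, hv k⟩, rfl, h⟩

theorem Def.isSatClass (hD : DefP D) (hD' : InDom D) (hS : DefP S) (hX : DefP X) (hY : DefP Y)
    (T : Fin 6 → α) :
    Def fun M v => IsSatClass (D M v) (S M v) (X M v) (Y M v) fun k => v (T k) := by
  have all : ∀ {β : Type} (f : α → β) {R : LevelStr.{u} → (β → ZFSet.{u}) → ZFSet.{u} → Prop},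
      Def (α := Option β) (fun M w => R M (fun a => w (some a)) (w none)) →
      Def fun M v => ∀ x, D M (fun a => v (f a)) x → R M v x := fun f _ h =>
    .allIn (hD.lift f) (hD'.lift f) h
  have ex : ∀ {β : Type} (f : α → β) {R : LevelStr.{u} → (β → ZFSet.{u}) → ZFSet.{u} → Prop},
      Def (α := Option β) (fun M w => R M (fun a => w (some a)) (w none)) →
      Def fun M v => ∃ x, D M (fun a => v (f a)) x ∧ R M v x := fun f _ h =>
    .exIn (hD.lift f) (hD'.lift f) h
  refine (Def.and ?_ (.and ?_ (.and ?_ (.and ?_ (.and ?_ ?_))))).congr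
    fun M hM v hv => ⟨fun ⟨h1, h2, h3, h4, h5, h6⟩ => ⟨h1, h2, h3, h4, h5, h6⟩,
      fun h => ⟨h.1, h.2, h.3, h.4, h.5, h.6⟩⟩
  · exact all _ (all _ (all _ (.imp (.tripleMem _ _ _ _) (all _ (.iff (hS.pair _ _ _)
      (ex _ (.and (.eqApp _ _ _) (.eqApp _ _ _))))))))
  · exact all _ (all _ (all _ (.imp (.tripleMem _ _ _ _) (all _ (.iff (hS.pair _ _ _)
      (ex _ (.and (.eqApp _ _ _) (ex _ (.and (.eqApp _ _ _) (.mem _ _))))))))))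
  · exact all _ (all _ (.imp (.pair_mem _ _ _) (all _ (.iff (hS.pair _ _ _)
      (ex _ (.and (.eqApp _ _ _) (hX.at _ _)))))))
  · exact all _ (all _ (.imp (.pair_mem _ _ _) (all _ (.iff (hS.pair _ _ _)
      (ex _ (.and (.eqApp _ _ _) (hY.at _ _)))))))
  · exact all _ (all _ (all _ (.imp (.tripleMem _ _ _ _) (all _ (.iff (hS.pair _ _ _)
      (.not (.and (hS.pair _ _ _) (hS.pair _ _ _))))))))
  · exact all _ (all _ (all _ (.imp (.tripleMem _ _ _ _) (all _ (.iff (hS.pair _ _ _)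
      (all _ (.imp (.agreeOff (hD.lift _) (hD'.lift _) _ _ _) (hS.pair _ _ _))))))))

end Definability

end

/-! ### Translation of first-order formulas into coded formulas -/

section

open scoped ZFSet
open ZFSet FirstOrder FirstOrder.Language

/-- The variable that a term of a relational language consists of. -/
def termVar {L : FirstOrder.Language.{0, 0}} [L.IsRelational] {β : Type v} : L.Term β → β
  | .var b => b
  | .func f _ => isEmptyElim f

theorem realize_eq_termVar {L : FirstOrder.Language.{0, 0}} [L.IsRelational] {β : Type v}
    {A : Type*} [L.Structure A] (t : L.Term β) (v : β → A) : t.realize v = v (termVar t) := by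
  cases t with
  | var b => rfl
  | func f _ => exact isEmptyElim f

instance : LSet.IsRelational := fun _ => inferInstanceAs (IsEmpty Empty)
instance : LSetXY.IsRelational := fun _ => inferInstanceAs (IsEmpty Empty)

namespace NFormula

def falsum : NFormula := nand (eq 0 0) (eq 0 0)

def imp (p q : NFormula) : NFormula := nand p (nand q q)

variable {A X Y : ZFSet.{u} → Prop} {g : ℕ → ZFSet.{u}}

theorem eval_falsum : ¬ falsum.Eval A X Y g := by simp [falsum, Eval]

theorem eval_imp {p q : NFormula} : (p.imp q).Eval A X Y g ↔ (p.Eval A X Y g → q.Eval A X Y g) := by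
  simp only [imp, Eval]
  tauto

/-- The number of a variable of a bounded formula. -/
def varNum {m n : ℕ} : Fin m ⊕ Fin n → ℕ := Sum.elim (fun i => i) fun j => m + j

/-- The translation of formulas of the language of set theory with two predicates. -/
def ofXY {m : ℕ} : ∀ {n : ℕ}, LSetXY.BoundedFormula (Fin m) n → NFormula
  | _, .falsum => falsum
  | _, .equal t₁ t₂ => eq (varNum (termVar t₁)) (varNum (termVar t₂))
  | _, .rel MemPredRel.mem ts => mem (varNum (termVar (ts 0))) (varNum (termVar (ts 1)))
  | _, .rel MemPredRel.predX ts => predX (varNum (termVar (ts 0)))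
  | _, .rel MemPredRel.predY ts => predY (varNum (termVar (ts 0)))
  | _, .imp φ ψ => (ofXY φ).imp (ofXY ψ)
  | n, .all φ => all (m + n) (ofXY φ)

/-- The translation of formulas of the language of set theory. -/
def ofSet {m : ℕ} : ∀ {n : ℕ}, LSet.BoundedFormula (Fin m) n → NFormula
  | _, .falsum => falsum
  | _, .equal t₁ t₂ => eq (varNum (termVar t₁)) (varNum (termVar t₂))
  | _, .rel MemRel.mem ts => mem (varNum (termVar (ts 0))) (varNum (termVar (ts 1)))
  | _, .imp φ ψ => (ofSet φ).imp (ofSet ψ)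
  | n, .all φ => all (m + n) (ofSet φ)

/-- Free variables are numbered below `m` and the bound ones from `m` on, so `m + n` is fresh and
stands for the next bound variable. -/
theorem varNum_update {m n : ℕ} {A : Set ZFSet.{u}} {v : Fin m → A} {xs : Fin n → A}
    (hg : ∀ b : Fin m ⊕ Fin n, g (varNum b) = (Sum.elim v xs b : A)) (a : A)
    (b : Fin m ⊕ Fin (n + 1)) : Function.update g (m + n) a (varNum b) =
      (Sum.elim v (Fin.snoc xs a : Fin (n + 1) → A) b : A) := by
  rcases b with i | j
  · rw [Function.update_of_ne (by simp [varNum]; omega)]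
    exact hg (.inl i)
  · refine Fin.lastCases ?_ (fun j => ?_) j
    · simp [varNum]
    · rw [Function.update_of_ne (by simp [varNum]; omega)]
      simpa [varNum] using hg (.inr j)

theorem eval_ofXY {A : Set ZFSet.{u}} {m n : ℕ} (φ : LSetXY.BoundedFormula (Fin m) n)
    {v : Fin m → A} {xs : Fin n → A}
    (hg : ∀ b : Fin m ⊕ Fin n, g (varNum b) = (Sum.elim v xs b : A)) :
    (ofXY φ).Eval (· ∈ A) X Y g ↔ @BoundedFormula.Realize LSetXY A
      (memPredStructure A {x | X x} {x | Y x}) (Fin m) n φ v xs := by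
  let := memPredStructure A {x | X x} {x | Y x}
  induction φ generalizing g with
  | falsum => exact iff_false_intro eval_falsum
  | equal t₁ t₂ =>
    simp only [ofXY, Eval, hg, BoundedFormula.Realize, realize_eq_termVar]
    exact Subtype.ext_iff.symm
  | rel R ts =>
    cases R <;> simp only [ofXY, Eval, hg, BoundedFormula.Realize, realize_eq_termVar] <;> rfl
  | imp φ ψ ihφ ihψ =>
    simp only [ofXY, eval_imp]
    exact imp_congr (ihφ hg) (ihψ hg)
  | all φ ih =>
    refine Iff.trans ?_ (Subtype.forall (p := (· ∈ A))).symm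
    exact forall_congr' fun a => forall_congr' fun ha => ih (varNum_update hg ⟨a, ha⟩)

theorem eval_ofSet {A : Set ZFSet.{u}} {m n : ℕ} (φ : LSet.BoundedFormula (Fin m) n)
    {v : Fin m → A} {xs : Fin n → A}
    (hg : ∀ b : Fin m ⊕ Fin n, g (varNum b) = (Sum.elim v xs b : A)) :
    (ofSet φ).Eval (· ∈ A) X Y g ↔ @BoundedFormula.Realize LSet A
      (memStructure A) (Fin m) n φ v xs := by
  let := memStructure A
  induction φ generalizing g with
  | falsum => exact iff_false_intro eval_falsum
  | equal t₁ t₂ =>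
    simp only [ofSet, Eval, hg, BoundedFormula.Realize, realize_eq_termVar]
    exact Subtype.ext_iff.symm
  | rel R ts =>
    cases R
    simp only [ofSet, Eval, hg, BoundedFormula.Realize, realize_eq_termVar]
    rfl
  | imp φ ψ ihφ ihψ =>
    simp only [ofSet, eval_imp]
    exact imp_congr (ihφ hg) (ihψ hg)
  | all φ ih =>
    refine Iff.trans ?_ (Subtype.forall (p := (· ∈ A))).symm
    exact forall_congr' fun a => forall_congr' fun ha => ih (varNum_update hg ⟨a, ha⟩)

end NFormula

end

/-! ### Absoluteness: `Δ₀`, `Π₁` and `Σ₂` formulas, and the Mostowski collapse -/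

section

open scoped ZFSet
open ZFSet FirstOrder FirstOrder.Language Cardinal

/-- `⟨A, ∈⟩ ⊨ φ[v, xs]`. -/
def BSat (A : Set ZFSet.{u}) {α : Type v} {n : ℕ} (φ : LSet.BoundedFormula α n) (v : α → A)
    (xs : Fin n → A) : Prop :=
  @BoundedFormula.Realize LSet A (memStructure A) α n φ v xs

variable {α : Type v} {n : ℕ} {A B : Set ZFSet.{u}}

theorem bSat_boundedAll {t : LSet.Term (α ⊕ Fin n)} {φ : LSet.BoundedFormula α (n + 1)}
    {v : α → A} {xs : Fin n → A} : BSat A (boundedAll t φ) v xs ↔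
      ∀ a : A, (a : ZFSet) ∈ (Sum.elim v xs (termVar t) : A).1 → BSat A φ v (Fin.snoc xs a) := by
  let := memStructure A
  refine forall_congr' fun a => imp_congr ?_ Iff.rfl
  refine (BoundedFormula.realize_rel₂ (L := LSet)).trans ?_
  rw [realize_eq_termVar, realize_eq_termVar]
  have h1 : (Sum.elim v (Fin.snoc xs a : Fin (n + 1) → A) (Sum.inr (Fin.last n)) : A) = a := by simp
  have h2 : (Sum.elim v (Fin.snoc xs a : Fin (n + 1) → A)
      (termVar (t.relabel (Sum.map id Fin.castSucc))) : A) = Sum.elim v xs (termVar t) := by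
    rw [← realize_eq_termVar (t.relabel (Sum.map id Fin.castSucc))
      (Sum.elim v (Fin.snoc xs a : Fin (n + 1) → A)), Term.realize_relabel, realize_eq_termVar]
    rcases termVar t with i | j <;> simp
  rw [h2]
  change (Sum.elim v (Fin.snoc xs a : Fin (n + 1) → A) (Sum.inr (Fin.last n)) : A).1 ∈ _ ↔ _
  rw [h1]
  exact Iff.rfl

theorem bSat_ex {φ : LSet.BoundedFormula α (n + 1)} {v : α → A} {xs : Fin n → A} :
    BSat A φ.ex v xs ↔ ∃ a : A, BSat A φ v (Fin.snoc xs a) :=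
  @BoundedFormula.realize_ex LSet A (memStructure A) _ _ _ _ _

/-- `A` is a transitive class. -/
def TransClass (A : Set ZFSet.{u}) : Prop := ∀ x ∈ A, ∀ y ∈ x, y ∈ A

theorem transClass_vSet (o : Ordinal.{u}) : TransClass (VSet o) :=
  fun _ hx _ hy => (isTransitive_vonNeumann o).mem_trans hy hx

theorem inclusion_snoc (h : A ⊆ B) (xs : Fin n → A) (a : A) :
    Set.inclusion h ∘ (Fin.snoc xs a : Fin (n + 1) → A) =
      Fin.snoc (Set.inclusion h ∘ xs) (Set.inclusion h a) :=
  Fin.comp_snoc _ _ _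

/-- A bounded quantifier ranges over the elements of a member of `A`, all of which are in `A` by
transitivity. -/
theorem IsDelta0.bSat_iff (hA : TransClass A) (h : A ⊆ B) {φ : LSet.BoundedFormula α n}
    (hφ : IsDelta0 φ) (v : α → A) (xs : Fin n → A) :
    BSat A φ v xs ↔ BSat B φ (Set.inclusion h ∘ v) (Set.inclusion h ∘ xs) := by
  induction hφ with
  | falsum => exact Iff.rfl
  | atomic hat =>
    let := memStructure A
    let := memStructure B
    cases hat with
    | equal t₁ t₂ =>
      simp only [BSat, Term.bdEqual, BoundedFormula.Realize, realize_eq_termVar, ← Sum.comp_elim,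
        Function.comp_apply]
      exact (Set.inclusion_injective h).eq_iff.symm
    | rel R ts =>
      cases R
      simp only [BSat, Relations.boundedFormula, BoundedFormula.Realize, realize_eq_termVar,
        ← Sum.comp_elim, Function.comp_apply]
      exact Iff.rfl
  | imp _ _ ihφ ihψ => exact imp_congr (ihφ xs) (ihψ xs)
  | ball t _ ih =>
    rw [bSat_boundedAll, bSat_boundedAll, ← Sum.comp_elim]
    constructor
    · intro H b hb
      have hbA : (b : ZFSet) ∈ A := hA _ (Sum.elim v xs (termVar t) : A).2 _ hb
      have := (ih _).1 (H ⟨b, hbA⟩ hb)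
      rwa [inclusion_snoc h] at this
    · intro H a ha
      rw [ih, inclusion_snoc h]
      exact H (Set.inclusion h a) ha

/-- `Π₁` formulas are downward absolute between transitive classes. -/
theorem AllBlock.bSat_down (hA : TransClass A) (h : A ⊆ B) {φ : LSet.BoundedFormula α n}
    (hφ : AllBlock (fun _ φ => IsDelta0 φ) n φ) (v : α → A) (xs : Fin n → A)
    (H : BSat B φ (Set.inclusion h ∘ v) (Set.inclusion h ∘ xs)) : BSat A φ v xs := by
  induction hφ with
  | base hφ => exact (hφ.bSat_iff hA h v xs).2 H
  | all _ ih => exact fun a => ih _ (by rw [inclusion_snoc h]; exact H _)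

/-- The failure of a `Π₁` formula in `V_o` is witnessed in all sufficiently large levels. -/
theorem AllBlock.exists_level_not_bSat {o : Ordinal.{u}} (ho : Order.IsSuccLimit o)
    {φ : LSet.BoundedFormula α n} (hφ : AllBlock (fun _ φ => IsDelta0 φ) n φ)
    (v : α → VSet o) (xs : Fin n → VSet o) (H : ¬ BSat (VSet o) φ v xs) :
    ∃ β < o, ∀ γ, β ≤ γ → γ ≤ o → ∀ (v' : α → VSet γ) (xs' : Fin n → VSet γ),
      (∀ i, (v' i : ZFSet) = v i) → (∀ i, (xs' i : ZFSet) = xs i) → ¬ BSat (VSet γ) φ v' xs' := by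
  induction hφ with
  | base hφ =>
    refine ⟨0, ho.bot_lt, fun γ _ hγ v' xs' hv hxs H' => H ?_⟩
    have hsub : VSet γ ⊆ VSet o := fun x hx => vonNeumann_subset_of_le hγ hx
    rw [hφ.bSat_iff (transClass_vSet γ) hsub] at H'
    convert H' using 1
    · funext i; exact Subtype.ext (hv i).symm
    · funext i; exact Subtype.ext (hxs i).symm
  | all _ ih =>
    obtain ⟨a, ha⟩ := not_forall.1 H
    obtain ⟨β, hβ, hh⟩ := ih _ ha
    -- The level must also be high enough to contain the counterexample `a`.
    refine ⟨max β (Order.succ (rank (a : ZFSet))),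
      max_lt hβ (ho.succ_lt (mem_vonNeumann.1 a.2)), fun γ hγ hγo v' xs' hv hxs H' => ?_⟩
    have haγ : (a : ZFSet) ∈ VSet γ :=
      mem_vonNeumann.2 (Order.succ_le_iff.1 ((le_max_right _ _).trans hγ))
    refine hh γ ((le_max_left _ _).trans hγ) hγo v' (Fin.snoc xs' ⟨a, haγ⟩) hv (fun i => ?_)
      (H' _)
    refine Fin.lastCases ?_ (fun j => ?_) i
    · simp
    · simpa using hxs j

/-! ### The Mostowski collapse -/

/-- The Mostowski collapse of the class `N`. -/
noncomputable def collapse (N : Set ZFSet.{u}) (z : ZFSet.{u}) : ZFSet.{u} :=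
  range fun y : (z.sep (· ∈ N) : ZFSet.{u}) => collapse N y
termination_by z
decreasing_by exact (ZFSet.mem_sep.1 y.2).1

theorem mem_collapse {N : Set ZFSet.{u}} {w z : ZFSet.{u}} :
    w ∈ collapse N z ↔ ∃ y ∈ z, y ∈ N ∧ collapse N y = w := by
  rw [collapse, mem_range]
  constructor
  · rintro ⟨⟨y, hy⟩, rfl⟩
    have := ZFSet.mem_sep.1 hy
    exact ⟨y, this.1, this.2, rfl⟩
  · rintro ⟨y, hy, hN, rfl⟩
    exact ⟨⟨y, ZFSet.mem_sep.2 ⟨hy, hN⟩⟩, rfl⟩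

/-- `∈`-induction: sets in `N` with the same collapse have the same elements in `N`, and `N` is
extensional. -/
theorem collapse_inj {N : Set ZFSet.{u}}
    (hN : ∀ a ∈ N, ∀ b ∈ N, (∀ c ∈ N, c ∈ a ↔ c ∈ b) → a = b) {a : ZFSet.{u}} :
    a ∈ N → ∀ b ∈ N, collapse N a = collapse N b → a = b := by
  induction a using ZFSet.inductionOn with
  | _ a ih =>
    intro ha b hb hab
    refine hN a ha b hb fun c hc => ⟨fun hca => ?_, fun hcb => ?_⟩
    · have : collapse N c ∈ collapse N b := hab ▸ mem_collapse.2 ⟨c, hca, hc, rfl⟩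
      obtain ⟨d, hd, hdN, hdc⟩ := mem_collapse.1 this
      rwa [ih c hca hc d hdN hdc.symm]
    · have : collapse N c ∈ collapse N a := hab ▸ mem_collapse.2 ⟨c, hcb, hc, rfl⟩
      obtain ⟨d, hd, hdN, hdc⟩ := mem_collapse.1 this
      rwa [← ih d hd hdN c hc hdc]

theorem collapse_eq_self {N : Set ZFSet.{u}} {A : Set ZFSet.{u}} (hA : TransClass A) (h : A ⊆ N)
    {z : ZFSet.{u}} : z ∈ A → collapse N z = z := by
  induction z using ZFSet.inductionOn with
  | _ z ih =>
    intro hz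
    ext w
    rw [mem_collapse]
    constructor
    · rintro ⟨y, hy, -, rfl⟩
      rwa [ih y hy (hA _ hz y hy)]
    · exact fun hw => ⟨w, hw, h (hA _ hz w hw), ih w hw (hA _ hz w hw)⟩

theorem card_lSet_le : LSet.card ≤ ℵ₀ := by
  have : Countable LSet.Symbols := by
    have : Countable (Σ n, LSet.Relations n) := by
      refine Function.Injective.countable (f := fun x => x.1) ?_
      rintro ⟨_, R⟩ ⟨_, R'⟩ h
      cases R
      cases R'
      rfl
    have : IsEmpty (Σ n, LSet.Functions n) := ⟨fun x => isEmptyElim x.2⟩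
    exact instCountableSum
  exact mk_le_aleph0

/-- Levels of the hierarchy are elementary in arbitrarily high sets up to a collapse. -/
theorem exists_transClass_equiv {δ γ : Ordinal.{u}} (hδ : Ordinal.omega0 ≤ δ) (hδγ : δ ≤ γ) :
    ∃ t : ZFSet.{u}, t.IsTransitive ∧ t.card ≤ (V_ δ).card ∧ VSet δ ⊆ {x | x ∈ t} ∧
      ∀ {α : Type v} {n : ℕ} (φ : LSet.BoundedFormula α n) (v : α → VSet γ) (xs : Fin n → VSet γ)
        (v' : α → {x | x ∈ t}) (xs' : Fin n → {x | x ∈ t}),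
        (∀ i, (v i : ZFSet) ∈ V_ δ) → (∀ i, (xs i : ZFSet) ∈ V_ δ) →
        (∀ i, (v' i : ZFSet) = v i) → (∀ i, (xs' i : ZFSet) = xs i) →
        (BSat (VSet γ) φ v xs ↔ BSat {x | x ∈ t} φ v' xs') := by
  let := memStructure (VSet γ)
  let s : Set (VSet γ) := {x | (x : ZFSet) ∈ V_ δ}
  have hsub : ∀ x ∈ V_ δ, x ∈ VSet γ := fun x hx => vonNeumann_subset_of_le hδγ hx
  have hs : #s = lift.{u + 1} (V_ δ).card := by
    rw [← cardinalMk_coe_sort]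
    exact mk_congr ⟨fun x => ⟨x.1.1, x.2⟩, fun x => ⟨⟨x.1, hsub _ x.2⟩, x.2⟩, fun _ => rfl,
      fun _ => rfl⟩
  have hinf : ℵ₀ ≤ #s := by
    rw [hs, aleph0_le_lift, card_vonNeumann, ← preBeth_omega]
    exact preBeth_mono hδ
  -- Downward Löwenheim-Skolem: an elementary substructure of `V_γ` that includes `V_δ` and has the
  -- size of `V_δ`.
  obtain ⟨S, hsS, hcard⟩ := exists_elementarySubstructure_card_eq LSet s #s hinf le_rfl
    (by simpa using (lift_le.2 card_lSet_le).trans (by simpa using hinf))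
    (by simpa using mk_set_le s)
  rw [Cardinal.lift_inj] at hcard
  let N : Set ZFSet.{u} := Subtype.val '' (S : Set (VSet γ))
  have hmemN : ∀ x : S, (x : VSet γ).1 ∈ N := fun x => ⟨x, x.2, rfl⟩
  have hNγ : ∀ x ∈ N, x ∈ V_ γ := by
    rintro _ ⟨x, -, rfl⟩
    exact x.2
  have hδN : VSet δ ⊆ N := fun x hx => ⟨⟨x, hsub x hx⟩, hsS hx, rfl⟩
  -- `V_γ` satisfies extensionality, hence so does its elementary substructure `N`.
  have hext : ∀ a ∈ N, ∀ b ∈ N, (∀ c ∈ N, c ∈ a ↔ c ∈ b) → a = b := by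
    rintro _ ⟨a, ha, rfl⟩ _ ⟨b, hb, rfl⟩ hc
    let mem (i : Fin 2) : LSet.BoundedFormula (Fin 2) 1 :=
      Relations.boundedFormula₂ (L := LSet) MemRel.mem (.var (.inr 0)) (.var (.inl i))
    let ψ : LSet.BoundedFormula (Fin 2) 0 := ((mem 0).iff (mem 1)).all
    have hψ := S.subtype.map_boundedFormula ψ ![⟨a, ha⟩, ⟨b, hb⟩] default
    simp only [ψ, BoundedFormula.realize_all, BoundedFormula.realize_iff, mem,
      BoundedFormula.realize_rel₂] at hψ
    have h2 := hψ.2 fun c => hc _ (hmemN c)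
    ext c
    constructor
    · exact fun h => (h2 ⟨c, transClass_vSet γ _ a.2 _ h⟩).1 h
    · exact fun h => (h2 ⟨c, transClass_vSet γ _ b.2 _ h⟩).2 h
  let t : ZFSet.{u} := range fun z : ((V_ γ).sep (· ∈ N) : ZFSet.{u}) => collapse N z
  have hmemt : ∀ x, x ∈ t ↔ ∃ z ∈ N, collapse N z = x := by
    intro x
    rw [mem_range]
    constructor
    · rintro ⟨⟨z, hz⟩, rfl⟩
      exact ⟨z, (ZFSet.mem_sep.1 hz).2, rfl⟩
    · rintro ⟨z, hz, rfl⟩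
      exact ⟨⟨z, ZFSet.mem_sep.2 ⟨hNγ z hz, hz⟩⟩, rfl⟩
  have hfix : ∀ x ∈ VSet δ, collapse N x = x := fun x =>
    collapse_eq_self (transClass_vSet δ) hδN
  refine ⟨t, ?_, ?_, ?_, ?_⟩
  · intro x hx y hy
    obtain ⟨z, -, rfl⟩ := (hmemt x).1 hx
    obtain ⟨w, -, hw, rfl⟩ := mem_collapse.1 hy
    exact (hmemt _).2 ⟨w, hw, rfl⟩
  · have h1 := lift_card_range_le
      (f := fun z : ((V_ γ).sep (· ∈ N) : ZFSet.{u}) => collapse N z)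
    rw [← lift_le.{u + 1}]
    refine h1.trans ?_
    rw [← hs, ← hcard, lift_id'.{u, u + 1}]
    refine mk_le_of_injective (f := fun z => (⟨⟨z.1, hNγ _ (ZFSet.mem_sep.1 z.2).2⟩, ?_⟩ : S)) ?_
    · obtain ⟨x, hx, hxz⟩ := (ZFSet.mem_sep.1 z.2).2
      have : x = ⟨z.1, hNγ _ (ZFSet.mem_sep.1 z.2).2⟩ := Subtype.ext hxz
      exact this ▸ hx
    · intro z z' h
      exact Subtype.ext (congrArg (fun x : S => (x : VSet γ).1) h)
  · exact fun x hx => (hmemt x).2 ⟨x, hδN hx, hfix x hx⟩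
  · intro α n φ v xs v' xs' hv hxs hv' hxs'
    let := memStructure {x | x ∈ t}
    let f : S → {x | x ∈ t} := fun x => ⟨collapse N (x : VSet γ).1, (hmemt _).2 ⟨_, hmemN x, rfl⟩⟩
    have hf : Function.Bijective f := by
      constructor
      · intro x y hxy
        exact Subtype.ext (Subtype.ext (collapse_inj hext (hmemN x) _ (hmemN y)
          (congrArg Subtype.val hxy)))
      · rintro ⟨x, hx⟩
        obtain ⟨_, ⟨z, hz, rfl⟩, rfl⟩ := (hmemt x).1 hx
        exact ⟨⟨z, hz⟩, rfl⟩
    let e : S ≃[LSet] {x | x ∈ t} :=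
      { Equiv.ofBijective f hf with
        map_fun' := fun g => isEmptyElim g
        map_rel' := fun {k} R xs => by
          cases R
          change collapse N _ ∈ collapse N _ ↔ ((xs 0 : VSet γ) : ZFSet) ∈ ((xs 1 : VSet γ) : ZFSet)
          rw [mem_collapse]
          constructor
          · rintro ⟨y, hy, hyN, h⟩
            rwa [← collapse_inj hext hyN _ (hmemN (xs 0)) h]
          · exact fun h => ⟨_, h, hmemN _, rfl⟩ }
    let vS : α → S := fun i => ⟨v i, hsS (hv i)⟩
    let xS : Fin n → S := fun i => ⟨xs i, hsS (hxs i)⟩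
    have h1 := S.subtype.map_boundedFormula φ vS xS
    have h2 := StrongHomClass.realize_boundedFormula e φ (v := vS) (xs := xS)
    have h3 : e ∘ vS = v' := funext fun i => Subtype.ext ((hfix _ (hv i)).trans (hv' i).symm)
    have h4 : e ∘ xS = xs' := funext fun i => Subtype.ext ((hfix _ (hxs i)).trans (hxs' i).symm)
    rw [h3, h4] at h2
    exact h1.trans h2.symm

theorem exists_level_of_finite {ι : Type*} [Finite ι] {o : Ordinal.{u}}
    (ho : Order.IsSuccLimit o) (w : ι → VSet o) : ∃ δ < o, ∀ i, (w i : ZFSet) ∈ V_ δ := by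
  have : Nonempty (Set.Iio o) := ⟨⟨0, ho.bot_lt⟩⟩
  obtain ⟨b, hb⟩ := (Set.finite_range fun i =>
    (⟨rank (w i : ZFSet), mem_vonNeumann.1 (w i).2⟩ : Set.Iio o)).bddAbove
  exact ⟨Order.succ b, ho.succ_lt b.2, fun i => mem_vonNeumann.2
    (Order.lt_succ_of_le (hb ⟨i, rfl⟩))⟩

/-- `Σ₂` formulas are upward absolute between `V_ξ` and `V_κ` for inaccessible `ξ < κ`. -/
theorem LevyClass.bSat_up {ξ κ : Cardinal.{u}} (hξ : ξ.IsInaccessible) (hκ : κ.IsInaccessible)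
    (hlt : ξ < κ) [Finite α] {φ : LSet.BoundedFormula α n} (hφ : LevyClass true 2 n φ)
    (v : α → VSet ξ.ord) (xs : Fin n → VSet ξ.ord) (v' : α → VSet κ.ord) (xs' : Fin n → VSet κ.ord)
    (hv : ∀ i, (v' i : ZFSet) = v i) (hxs : ∀ i, (xs' i : ZFSet) = xs i)
    (H : BSat (VSet ξ.ord) φ v xs) : BSat (VSet κ.ord) φ v' xs' := by
  induction hφ with
  | ex _ ih =>
    obtain ⟨a, ha⟩ := bSat_ex.1 H
    refine bSat_ex.2 ⟨⟨a, vonNeumann_subset_of_le (ord_le_ord.2 hlt.le) a.2⟩,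
      ih _ _ (fun i => ?_) ha⟩
    refine Fin.lastCases ?_ (fun j => ?_) i
    · simp
    · simpa using hxs j
  | @base n φ hφ =>
    replace hφ : AllBlock (fun _ φ => IsDelta0 φ) n φ := hφ
    -- A failure of the `Π₁` part in `V_κ` shows in `V_γ` for every `γ` from some `β < κ` up to `κ`.
    -- The collapse of a hull of `V_δ` in `V_γ` is a transitive set of size `< ξ`, thus included in
    -- `V_ξ`, and it fixes the parameters. The formula holds there since `Π₁` formulas go down, and
    -- so it holds in `V_γ`.
    by_contra hn
    have hξl := isSuccLimit_ord hξ.aleph0_lt.le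
    have hlt' : ξ.ord < κ.ord := ord_strictMono hlt
    obtain ⟨β, hβ, hβ'⟩ := hφ.exists_level_not_bSat (isSuccLimit_ord hκ.aleph0_lt.le) v' xs' hn
    obtain ⟨δ, hδ, hδω, hvδ, hxδ⟩ : ∃ δ < ξ.ord, Ordinal.omega0 ≤ δ ∧
        (∀ i, (v i : ZFSet) ∈ V_ δ) ∧ ∀ i, (xs i : ZFSet) ∈ V_ δ := by
      obtain ⟨δ₁, h1, h1'⟩ := exists_level_of_finite hξl v
      obtain ⟨δ₂, h2, h2'⟩ := exists_level_of_finite hξl xs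
      have hω : Ordinal.omega0 < ξ.ord := by simpa using ord_strictMono hξ.aleph0_lt
      exact ⟨max Ordinal.omega0 (max δ₁ δ₂), max_lt hω (max_lt h1 h2), le_max_left _ _,
        fun i => vonNeumann_subset_of_le ((le_max_left _ _).trans (le_max_right _ _)) (h1' i),
        fun i => vonNeumann_subset_of_le ((le_max_right _ _).trans (le_max_right _ _)) (h2' i)⟩
    let γ := max β δ
    have hδγ : δ ≤ γ := le_max_right _ _
    have hγ : γ ≤ κ.ord := max_le hβ.le (hδ.trans hlt').le
    have hsub : ∀ x ∈ V_ δ, x ∈ VSet γ := fun x hx => vonNeumann_subset_of_le hδγ hx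
    obtain ⟨t, ht, htc, hδt, hiff⟩ := exists_transClass_equiv hδω hδγ
    have htξ : ∀ x ∈ t, x ∈ VSet ξ.ord := by
      intro x hx
      rw [← hSet_eq_vSet hξ]
      refine ⟨t, ht, ht x hx, htc.trans_lt (card_lt_of_mem_vonNeumann hξ ?_)⟩
      exact vonNeumann_mem_of_lt hδ
    refine hβ' γ (le_max_left _ _) hγ (fun i => ⟨v i, hsub _ (hvδ i)⟩)
      (fun i => ⟨xs i, hsub _ (hxδ i)⟩) (fun i => (hv i).symm) (fun i => (hxs i).symm) ?_
    refine (hiff φ _ _ (fun i => ⟨v i, hδt (hvδ i)⟩) (fun i => ⟨xs i, hδt (hxδ i)⟩) hvδ hxδ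
      (fun _ => rfl) fun _ => rfl).2 ?_
    exact hφ.bSat_down (fun x hx y hy => ht x hx hy) htξ _ _ H

end

/-! ### From definable relations to `Σ¹₂` sentences; tuples; definability of levels -/

section

open scoped ZFSet
open ZFSet FirstOrder FirstOrder.Language Ordinal

/-! ### `Σ¹₂` sentences from definable relations -/

theorem isSuccLimit_iff_forall_exists {o : Ordinal.{u}} (h : Nonempty (VSet o)) :
    Order.IsSuccLimit o ↔ ∀ x : VSet o, ∃ y : VSet o, (x : ZFSet) ∈ (y : ZFSet) := by
  constructor
  · intro ho x
    obtain ⟨y, hy, hxy⟩ := isLimitDom_vonNeumann ho x x.2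
    exact ⟨⟨y, hy⟩, hxy⟩
  · intro H
    refine isSuccLimit_of_isLimitDom (fun x hx => ?_) ⟨h.some, h.some.2⟩
    obtain ⟨y, hy⟩ := H ⟨x, hx⟩
    exact ⟨y, y.2, hy⟩

/-- A formula saying that every set is a member of a set. -/
def limitFormula : LSetXY.Formula (Fin 1) :=
  (Relations.boundedFormula₂ (L := LSetXY) (α := Fin 1) (n := 2) MemPredRel.mem
    (.var (.inr 0)) (.var (.inr 1))).ex.all

theorem Def.exists_sigma12 {R : LevelStr.{u} → (Fin 1 → ZFSet.{u}) → Prop} (h : Def R) :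
    ∃ Φ : LSetXY.Formula (Fin 1), ∀ (ξ : Ordinal.{u}) (p : ZFSet.{u}) (hp : p ∈ VSet ξ),
      SatSigma12 (VSet ξ) Φ ⟨p, hp⟩ ↔
        Order.IsSuccLimit ξ ∧ ∃ X, ∀ Y, R ⟨ξ, X, Y⟩ fun _ => p := by
  obtain ⟨φ, hφ⟩ := h
  -- `φ` is reliable only over limit levels, so the sentence has to assert that its level is one.
  refine ⟨limitFormula ⊓ φ, fun ξ p hp => ?_⟩
  have key : ∀ X Y : ZFSet.{u} → Prop,
      @Formula.Realize LSetXY (VSet ξ) (memPredStructure (VSet ξ) {x | X x} {x | Y x}) (Fin 1)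
        (limitFormula ⊓ φ) (fun _ => ⟨p, hp⟩) ↔
      Order.IsSuccLimit ξ ∧ R ⟨ξ, X, Y⟩ fun _ => p := by
    intro X Y
    let := memPredStructure (VSet ξ) {x | X x} {x | Y x}
    have h1 : Formula.Realize limitFormula (fun _ : Fin 1 => (⟨p, hp⟩ : VSet ξ)) ↔
        Order.IsSuccLimit ξ := by
      rw [isSuccLimit_iff_forall_exists ⟨p, hp⟩]
      refine BoundedFormula.realize_all.trans (forall_congr' fun x => ?_)
      refine BoundedFormula.realize_ex.trans (exists_congr fun y => ?_)
      exact BoundedFormula.realize_rel₂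
    rw [Formula.realize_inf, h1]
    exact and_congr_right fun hξ => hφ ⟨ξ, X, Y⟩ hξ _
  constructor
  · rintro ⟨X, hX⟩
    have hX' : ∀ Y : ZFSet.{u} → Prop, _ := fun Y =>
      (key (fun z => ∃ hz, (⟨z, hz⟩ : VSet ξ) ∈ X) Y).1 (by
        convert hX {x | Y x} using 2
        ext x
        exact ⟨fun ⟨_, h⟩ => h, fun h => ⟨x.2, h⟩⟩)
    exact ⟨(hX' fun _ => True).1, _, fun Y => (hX' Y).2⟩
  · rintro ⟨hξ, X, hX⟩
    refine ⟨{x | X x}, fun Y => ?_⟩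
    have := (key X fun z => ∃ hz, (⟨z, hz⟩ : VSet ξ) ∈ Y).2 ⟨hξ, hX _⟩
    convert this using 2
    ext x
    exact ⟨fun h => ⟨x.2, h⟩, fun ⟨_, h⟩ => h⟩

/-! ### Tuples -/

/-- The tuple of the entries of `T` and of `r`. -/
def tup : ∀ {n : ℕ}, (Fin n → ZFSet.{u}) → ZFSet.{u} → ZFSet.{u}
  | 0, _, r => r
  | _ + 1, T, r => pair (T 0) (tup (Fin.tail T) r)

theorem tup_inj {n : ℕ} {T T' : Fin n → ZFSet.{u}} {r r' : ZFSet.{u}} :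
    tup T r = tup T' r' ↔ T = T' ∧ r = r' := by
  induction n with
  | zero => exact ⟨fun h => ⟨Subsingleton.elim _ _, h⟩, fun h => h.2⟩
  | succ n ih =>
    rw [tup, tup, pair_inj, ih, ← and_assoc]
    refine and_congr_left fun _ => ⟨fun h => ?_, fun h => h ▸ ⟨rfl, rfl⟩⟩
    rw [← Fin.cons_self_tail T, ← Fin.cons_self_tail T', h.1, h.2]

/-- A `Σ¹₂` statement has a single parameter; the tables, the code and the assignment are packed
into it, and a level that contains the tuple contains them all. -/
theorem tup_mem_level {o : Ordinal.{u}} (ho : Order.IsSuccLimit o) {n : ℕ} {T : Fin n → ZFSet.{u}}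
    {r : ZFSet.{u}} : tup T r ∈ V_ o ↔ (∀ k, T k ∈ V_ o) ∧ r ∈ V_ o := by
  induction n with
  | zero => exact ⟨fun h => ⟨fun k => k.elim0, h⟩, fun h => h.2⟩
  | succ n ih =>
    rw [tup, opair_mem_level ho, ih, Fin.forall_fin_succ, and_assoc]
    rfl

section Definability

variable {α : Type}

theorem Def.exPair {R : LevelStr.{u} → (α → ZFSet.{u}) → ZFSet.{u} → ZFSet.{u} → Prop} (i : α)
    (h : Def (α := Option (Option α)) fun M w =>
      R M (fun a => w (some (some a))) (w (some none)) (w none)) :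
    Def fun M v => ∃ x y, v i = pair x y ∧ R M v x y :=
  (Def.ex (R := fun M v x => ∃ y ∈ V_ M.o, v i = pair x y ∧ R M v x y)
    (.ex (.and (.eqPair _ _ _) h))).congr fun M hM v hv => by
    constructor
    · rintro ⟨x, -, y, -, h⟩
      exact ⟨x, y, h⟩
    · rintro ⟨x, y, h, h'⟩
      have := (opair_mem_level hM).1 (h ▸ hv i)
      exact ⟨x, this.1, y, this.2, h, h'⟩

theorem Def.exTup {n : ℕ} {R : LevelStr.{u} → (α → ZFSet.{u}) → (Fin n → ZFSet.{u}) → ZFSet.{u} →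
    Prop} (i : α)
    (h : ∀ {β : Type} (f : α → β) (T : Fin n → β) (r : β),
      Def fun M v => R M (fun a => v (f a)) (fun k => v (T k)) (v r)) :
    Def fun M v => ∃ T r, v i = tup T r ∧ R M v T r := by
  induction n generalizing α with
  | zero =>
    refine (h id Fin.elim0 i).congr fun M hM v hv => ?_
    constructor
    · exact fun h => ⟨_, v i, rfl, h⟩
    · rintro ⟨T, r, h, H⟩
      rw [show v i = r from h, Subsingleton.elim (fun k : Fin 0 => v k.elim0) T]
      exact H
  | succ n ih =>
    refine (Def.exPair (R := fun M v x y => ∃ T r, y = tup T r ∧ R M v (Fin.cons x T) r) i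
      (ih none fun f T r => ?_)).congr fun M hM v hv => ?_
    · refine (h (fun a => f (some (some a))) (Fin.cons (f (some none)) T) r).congr
        fun M hM v hv => iff_of_eq ?_
      congr 1
      funext k
      exact Fin.cases rfl (fun _ => rfl) k
    · constructor
      · rintro ⟨x, _, h, T, r, rfl, H⟩
        exact ⟨_, r, by rw [h, tup, Fin.cons_zero, Fin.tail_cons], H⟩
      · rintro ⟨T, r, h, H⟩
        refine ⟨T 0, _, h, Fin.tail T, r, rfl, ?_⟩
        rwa [Fin.cons_self_tail]

end Definability

/-! ### Levels -/

/-- `H` consists of levels of the cumulative hierarchy and is closed under smaller levels. -/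
def IsHistory (H : ZFSet.{u}) : Prop := ∀ w ∈ H, ∀ x, x ∈ w ↔ ∃ u ∈ H, u ∈ w ∧ x ⊆ u

/-- `∈`-induction along the recursion `V_a = ⋃ {𝒫(V_b) : b < a}`. A set `x` of rank below `w` has
rank at most that of some `y ∈ w`; this `y` is included in a level `u ∈ w`, and hence so is `x`. -/
theorem IsHistory.eq_vonNeumann {H : ZFSet.{u}} (hH : IsHistory H) {w : ZFSet.{u}} :
    w ∈ H → w = V_ (rank w) := by
  induction w using ZFSet.inductionOn with
  | _ w ih =>
    intro hw
    ext x
    rw [hH w hw x, mem_vonNeumann]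
    constructor
    · rintro ⟨u, -, huw, hxu⟩
      exact (rank_mono hxu).trans_lt (rank_lt_of_mem huw)
    · intro hx
      obtain ⟨y, hy, hxy⟩ := lt_rank_iff.1 hx
      obtain ⟨u, hu, huw, hyu⟩ := (hH w hw y).1 hy
      refine ⟨u, hu, huw, ?_⟩
      rw [ih u huw hu, subset_vonNeumann]
      exact hxy.trans (rank_mono hyu)

/-- The set of all `V_b` with `b ≤ a`. -/
noncomputable def levels (a : Ordinal.{u}) : ZFSet.{u} := range fun b : Set.Iic a => V_ b.1

theorem mem_levels {a : Ordinal.{u}} {x : ZFSet.{u}} : x ∈ levels a ↔ ∃ b ≤ a, V_ b = x := by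
  rw [levels, mem_range]
  exact ⟨fun ⟨b, h⟩ => ⟨b, b.2, h⟩, fun ⟨b, h, h'⟩ => ⟨⟨b, h⟩, h'⟩⟩

theorem isHistory_levels (a : Ordinal.{u}) : IsHistory (levels a) := by
  intro w hw x
  obtain ⟨b, hb, rfl⟩ := mem_levels.1 hw
  rw [mem_vonNeumann']
  constructor
  · rintro ⟨c, hc, hx⟩
    exact ⟨_, mem_levels.2 ⟨c, (hc.trans_le hb).le, rfl⟩, vonNeumann_mem_of_lt hc, hx⟩
  · rintro ⟨u, hu, huw, hx⟩
    obtain ⟨c, -, rfl⟩ := mem_levels.1 hu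
    exact ⟨c, vonNeumann_mem_vonNeumann_iff.1 huw, hx⟩

theorem levels_mem_level {a o : Ordinal.{u}} (ho : Order.IsSuccLimit o) (ha : a < o) :
    levels a ∈ V_ o := by
  refine mem_vonNeumann.2 (lt_of_le_of_lt (rank_le_iff.2 fun x hx => ?_) (ho.succ_lt ha))
  obtain ⟨b, hb, rfl⟩ := mem_levels.1 hx
  rw [rank_vonNeumann]
  exact Order.lt_succ_of_le hb

/-- A level is a member of some history. The canonical one, `levels a`, has rank at most `a + 1`, so
it lies in every limit level above `a`. -/
theorem Def.isLevel {α : Type} (i : α) :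
    Def fun (_ : LevelStr.{u}) (v : α → ZFSet.{u}) => ∃ a, v i = V_ a := by
  refine (Def.ex (R := fun M v H => v i ∈ H ∧ ∀ w ∈ H, ∀ x ∈ V_ M.o, x ∈ w ↔
      ∃ u ∈ H, u ∈ w ∧ x ⊆ u)
    (.and (.mem _ _) (.ball _ (.all (.iff (.mem _ _) (.bex _ (.and (.mem _ _)
      (.subset _ _)))))))).congr fun M hM v hv => ?_
  constructor
  · rintro ⟨H, hH, hi, hh⟩
    refine ⟨rank (v i), IsHistory.eq_vonNeumann (H := H) (fun w hw x => ?_) hi⟩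
    have hHo := (isTransitive_vonNeumann M.o).subset_of_mem hH
    refine ⟨fun hx => (hh w hw x ?_).1 hx, fun hx => (hh w hw x ?_).2 hx⟩
    · exact (isTransitive_vonNeumann _).mem_trans hx (hHo hw)
    · obtain ⟨u, hu, -, hxu⟩ := hx
      exact mem_vonNeumann_of_subset hxu (hHo hu)
  · rintro ⟨a, ha⟩
    have hao : a < M.o := by simpa [ha] using hv i
    refine ⟨levels a, levels_mem_level hM hao, mem_levels.2 ⟨a, le_rfl, ha.symm⟩,
      fun w hw x _ => isHistory_levels a w hw x⟩

end

/-! ### Part (1): clubs, and the two reflected sentences -/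

section

open scoped ZFSet
open ZFSet FirstOrder FirstOrder.Language Ordinal

/-! ### Clubs -/

/-- The class `P` of members of `D` is a closed unbounded class of ordinals. -/
def IsClubIn (D P : ZFSet.{u} → Prop) : Prop :=
  (∀ b, D b → P b → b.IsOrdinal) ∧ (∀ x, D x → ∃ b, D b ∧ ¬ b ∈ x ∧ P b) ∧
    ∀ g, D g → g.IsOrdinal → ¬ g = ∅ → (∀ x ∈ g, ∃ b ∈ g, x ∈ b ∧ P b) → P g

/-- Closure under suprema of subsets becomes closure under limit points, which is first-order: a
limit point is the supremum of the members below it, and a supremum outside a set is a limit point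
of that set. -/
theorem isClub_iff {o : Ordinal.{u}} {C : Set (Set.Iio o)} {P : ZFSet.{u} → Prop}
    (hP : ∀ b ∈ V_ o, P b ↔ ∃ η ∈ C, b = (η : Ordinal.{u}).toZFSet) :
    IsClub C ↔ IsClubIn (· ∈ V_ o) P := by
  have hmem : ∀ η : Set.Iio o, (η : Ordinal.{u}).toZFSet ∈ V_ o := fun η =>
    mem_vonNeumann.2 (by rw [rank_toZFSet]; exact η.2)
  have hPC : ∀ η : Set.Iio o, P (η : Ordinal.{u}).toZFSet ↔ η ∈ C := fun η => by
    rw [hP _ (hmem η)]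
    constructor
    · rintro ⟨η', h, h'⟩
      rwa [Subtype.ext (toZFSet_injective h')]
    · exact fun h => ⟨η, h, rfl⟩
  constructor
  · intro hC
    refine ⟨fun b hb hPb => ?_, fun x hx => ?_, fun g hg hgo hg0 H => ?_⟩
    · obtain ⟨η, -, rfl⟩ := (hP b hb).1 hPb
      exact isOrdinal_toZFSet _
    · obtain ⟨η, hη, hle⟩ := hC.isCofinal ⟨rank x, mem_vonNeumann.1 hx⟩
      refine ⟨_, hmem η, fun h => ?_, (hPC η).2 hη⟩
      have := rank_lt_of_mem h
      rw [rank_toZFSet] at this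
      exact this.not_ge hle
    · let γ : Set.Iio o := ⟨rank g, mem_vonNeumann.1 hg⟩
      have hγ : (γ : Ordinal.{u}).toZFSet = g := hgo.toZFSet_rank_eq
      have hlim : ∀ x < γ.1, ∃ η ∈ C, η < γ ∧ x < η.1 := by
        intro x hx
        obtain ⟨b, hb, hxb, hPb⟩ := H x.toZFSet (hγ ▸ toZFSet_mem_toZFSet_iff.2 hx)
        obtain ⟨η, hη, rfl⟩ := (hP b ((isTransitive_vonNeumann o).mem_trans hb hg)).1 hPb
        rw [← hγ] at hb
        exact ⟨η, hη, toZFSet_mem_toZFSet_iff.1 hb, toZFSet_mem_toZFSet_iff.1 hxb⟩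
      rw [← hγ, hPC]
      refine hC.isLUB_mem (t := {η | η ∈ C ∧ η < γ}) (fun η h => h.1) ?_
        ⟨fun η h => h.2.le, fun δ hδ => ?_⟩
      · have h0 : (0 : Ordinal.{u}) < γ.1 := by
          refine pos_iff_ne_zero.2 fun h0 => hg0 ?_
          rw [← hγ, h0, toZFSet_zero]
        obtain ⟨η, h1, h2, -⟩ := hlim 0 h0
        exact ⟨η, h1, h2⟩
      · by_contra! hlt
        obtain ⟨η, h1, h2, h3⟩ := hlim δ.1 hlt
        exact h3.not_ge (hδ ⟨h1, h2⟩)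
  · rintro ⟨-, hunb, hcl⟩
    refine ⟨fun d hd hne _ a ha => ?_, fun a => ?_⟩
    · by_cases had : a ∈ d
      · exact hd had
      rw [← hPC]
      have hlt : ∀ η ∈ d, η < a := fun η hη =>
        (ha.1 hη).lt_of_ne fun h => had (h ▸ hη)
      refine hcl _ (hmem a) (isOrdinal_toZFSet _) ?_ fun x hx => ?_
      · obtain ⟨η, hη⟩ := hne
        intro h0
        have := toZFSet_mem_toZFSet_iff.2 (hlt η hη)
        rw [h0] at this
        exact notMem_empty _ this
      · obtain ⟨c, hc, rfl⟩ := mem_toZFSet_iff.1 hx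
        by_contra! hn
        have hle : a ≤ ⟨c, hc.trans a.2⟩ := ha.2 fun η hη => by
          by_contra! hcη
          exact hn (η : Ordinal.{u}).toZFSet (toZFSet_mem_toZFSet_iff.2 (hlt η hη))
            (toZFSet_mem_toZFSet_iff.2 hcη) ((hPC η).2 (hd hη))
        exact hc.not_ge hle
    · obtain ⟨b, hb, hba, hPb⟩ := hunb _ (hmem a)
      obtain ⟨η, hη, rfl⟩ := (hP b hb).1 hPb
      rw [toZFSet_mem_toZFSet_iff, not_lt] at hba
      exact ⟨η, hη, hba⟩

/-! ### Solution sets of coded formulas -/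

/-- `b` satisfies the formula with code `t` if the other variables have the values given by `s`. -/
def InSol (D S : ZFSet.{u} → Prop) (t s b : ZFSet.{u}) : Prop :=
  ∀ n, D n → n = ∅ → ∀ r, D r → AgreeOff D n s r → b = app r n → S (pair t r)

theorem IsSatClass.inSol_iff {o : Ordinal.{u}} (ho : Order.IsSuccLimit o) (hω : ω < o)
    {S X Y : ZFSet.{u} → Prop} (h : IsSatClass (· ∈ V_ o) S X Y codeTable) (q : NFormula)
    {s b : ZFSet.{u}} (hs : s ∈ V_ o) (hb : b ∈ V_ o) :
    InSol (· ∈ V_ o) S q.code s b ↔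
      q.Eval (· ∈ V_ o) X Y (Function.update (values s) 0 b) := by
  have h0 : ∀ r, app r ∅ = values r 0 := fun r => by rw [values, natSet_zero]
  constructor
  · intro H
    obtain ⟨t, ht, hst, htv⟩ := exists_values_update ho hω 0 hs hb
    rw [← htv, ← h.iff_eval ho hω q ht]
    refine H ∅ (by simpa [mem_vonNeumann] using ho.bot_lt) rfl t ht (natSet_zero ▸ hst) ?_
    rw [h0, htv, Function.update_self]
  · rintro H _ - rfl r hr hsr rfl
    rw [h.iff_eval ho hω q hr, values_of_agreeOff ho hω hs hr (natSet_zero.{u} ▸ hsr), ← h0]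
    exact H

/-- Variable `0` holds the candidate element, and variable `i + 1` the `i`-th parameter. -/
theorem eval_ofSet_update {o : Ordinal.{u}} {X Y : ZFSet.{u} → Prop} {m : ℕ}
    (φ : LSet.Formula (Fin (m + 1))) (s : ZFSet.{u}) (b : VSet o) (p : Fin m → VSet o)
    (hp : ∀ i : Fin m, values s (i + 1) = p i) :
    (NFormula.ofSet φ).Eval (· ∈ V_ o) X Y (Function.update (values s) 0 b) ↔
      Sat (VSet o) φ (Fin.cons b p) := by
  refine NFormula.eval_ofSet (A := VSet o) φ (v := Fin.cons b p) (xs := default) fun c => ?_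
  rcases c with i | j
  · refine Fin.cases ?_ (fun i => ?_) i
    · simp [NFormula.varNum]
    · simpa [NFormula.varNum] using hp i
  · exact j.elim0

/-- The ordinal `b` is an inaccessible cardinal, in terms of levels in `D`. -/
def IsInaccOrdIn (D : ZFSet.{u} → Prop) (b : ZFSet.{u}) : Prop :=
  ∃ A, D A ∧ (∃ a, A = V_ a) ∧ b ⊆ A ∧ ¬ b ∈ A ∧ ∀ Y, D Y → InaccessibleWith (· ∈ A) (· ∈ Y)

theorem toZFSet_subset_vonNeumann_iff {a b : Ordinal.{u}} : a.toZFSet ⊆ V_ b ↔ a ≤ b := by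
  rw [subset_vonNeumann, rank_toZFSet]

theorem toZFSet_mem_vonNeumann_iff {a b : Ordinal.{u}} : a.toZFSet ∈ V_ b ↔ a < b := by
  rw [mem_vonNeumann, rank_toZFSet]

/-- `η ⊆ A` and `η ∉ A` force the level `A` to be `V_η`, whose subsets are members of `V_o`. -/
theorem isInaccOrdIn_iff {o η : Ordinal.{u}} (h : η < o) :
    IsInaccOrdIn (· ∈ V_ o) η.toZFSet ↔ ∃ μ : Cardinal.{u}, μ.IsInaccessible ∧ η = μ.ord := by
  rw [← forall_inaccessibleWith_iff, ← forall_mem_inaccessibleWith_iff h]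
  constructor
  · rintro ⟨_, -, ⟨a, rfl⟩, h1, h2, H⟩
    rw [toZFSet_subset_vonNeumann_iff] at h1
    rw [toZFSet_mem_vonNeumann_iff, not_lt] at h2
    obtain rfl := h1.antisymm h2
    exact H
  · exact fun H => ⟨_, vonNeumann_mem_of_lt h, ⟨η, rfl⟩, toZFSet_subset_vonNeumann_iff.2 le_rfl,
      fun h => (toZFSet_mem_vonNeumann_iff.1 h).false, H⟩

/-! ### The two sentences -/

/-- `X` is a satisfaction class, the solution set of `t` with parameters `s` is unbounded, and the
domain is inaccessible as far as `Y` is concerned. -/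
def UnboundedSentence (D X Y : ZFSet.{u} → Prop) (T : Fin 6 → ZFSet.{u}) (t s : ZFSet.{u}) : Prop :=
  IsSatClass D X (fun _ => False) (fun _ => False) T ∧
    (∀ x, D x → ∃ b, D b ∧ ¬ b ∈ x ∧ InSol D X t s b) ∧ InaccessibleWith D Y

/-- `X` is a satisfaction class, each club defined by a formula with code in `F` contains an
inaccessible cardinal, and the domain is inaccessible as far as `Y` is concerned. -/
def MahloSentence (D X Y : ZFSet.{u} → Prop) (T : Fin 6 → ZFSet.{u}) (F : ZFSet.{u}) : Prop :=
  IsSatClass D X (fun _ => False) (fun _ => False) T ∧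
    (∀ t ∈ F, ∀ s, D s → IsClubIn D (InSol D X t s) →
      ∃ b, D b ∧ InSol D X t s b ∧ IsInaccOrdIn D b) ∧ InaccessibleWith D Y

section Definability

variable {α : Type}

theorem DefP.predX : DefP fun (M : LevelStr.{u}) (_ : α → ZFSet.{u}) => M.X := Def.predX none

theorem DefP.predY : DefP fun (M : LevelStr.{u}) (_ : α → ZFSet.{u}) => M.Y := Def.predY none

theorem DefP.false : DefP fun (_ : LevelStr.{u}) (_ : α → ZFSet.{u}) _ => False := Def.false

variable {D S P : LevelStr.{u} → (α → ZFSet.{u}) → ZFSet.{u} → Prop}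

theorem Def.inSol (hD : DefP D) (hD' : InDom D) (hS : DefP S) (i j k : α) :
    Def fun M v => InSol (D M v) (S M v) (v i) (v j) (v k) :=
  .allIn hD hD' (.imp (.eqEmpty _) (.allIn (hD.lift _) (hD'.lift _)
    (.imp (.agreeOff (hD.lift _) (hD'.lift _) _ _ _) (.imp (.eqApp _ _ _) (hS.pair _ _ _)))))

theorem Def.isClubIn (hD : DefP D) (hD' : InDom D) (hP : DefP P) :
    Def fun M v => IsClubIn (D M v) (P M v) := by
  refine .and (.allIn hD hD' (.imp hP (.isOrdinal _))) (.and ?_ ?_)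
  · exact .allIn hD hD' (.exIn (hD.lift _) (hD'.lift _) (.and (.not (.mem _ _)) (hP.at _ _)))
  · exact .allIn hD hD' (.imp (.isOrdinal _) (.imp (.not (.eqEmpty _)) (.imp
      (.ball _ (.bex _ (.and (.mem _ _) (hP.at _ _)))) hP)))

theorem Def.isInaccOrdIn (hD : DefP D) (hD' : InDom D) (i : α) :
    Def fun M v => IsInaccOrdIn (D M v) (v i) :=
  .exIn hD hD' (.and (.isLevel _) (.and (.subset _ _) (.and (.not (.mem _ _))
    (.allIn (hD.lift _) (hD'.lift _) (.inaccessibleWith (.memVar _) (.memVar _) (.memVar _))))))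

theorem Def.unboundedSentence (T : Fin 6 → α) (i j : α) :
    Def fun M v => UnboundedSentence.{u} (· ∈ V_ M.o) M.X M.Y (fun k => v (T k)) (v i) (v j) :=
  .and (.isSatClass .dom .dom .predX .false .false T)
    (.and (.all (.ex (.and (.not (.mem _ _)) (.inSol .dom .dom .predX _ _ _))))
      (.inaccessibleWith .dom .dom .predY))

theorem Def.mahloSentence (T : Fin 6 → α) (i : α) :
    Def fun M v => MahloSentence.{u} (· ∈ V_ M.o) M.X M.Y (fun k => v (T k)) (v i) :=
  .and (.isSatClass .dom .dom .predX .false .false T)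
    (.and (.ball _ (.all (.imp
        (.isClubIn .dom .dom (.inSol .dom .dom .predX (some (some none)) (some none) none))
        (.ex (.and (.inSol .dom .dom .predX _ _ _) (.isInaccOrdIn .dom .dom _))))))
      (.inaccessibleWith .dom .dom .predY))

end Definability

/-- The reflection property for sentences with tables, given by definable relations. -/
theorem IsSigma12Indescribable.reflect {κ : Cardinal.{u}} (hκ : IsSigma12Indescribable κ)
    {R : LevelStr.{u} → (Fin 6 → ZFSet.{u}) → ZFSet.{u} → ZFSet.{u} → Prop}
    (hR : ∀ {β : Type} (T : Fin 6 → β) (i j : β),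
      Def fun M v => R M (fun k => v (T k)) (v i) (v j))
    {t s : ZFSet.{u}} (ht : t ∈ V_ κ.ord) (hs : s ∈ V_ κ.ord) {X : ZFSet.{u} → Prop}
    (h : ∀ Y, R ⟨κ.ord, X, Y⟩ codeTable t s) :
    ∃ ξ < κ.ord, t ∈ V_ ξ ∧ s ∈ V_ ξ ∧ Order.IsSuccLimit ξ ∧
      ∃ X, ∀ Y, R ⟨ξ, X, Y⟩ codeTable t s := by
  have hlim := Cardinal.isSuccLimit_ord hκ.1.aleph0_lt.le
  have hω : ω < κ.ord := by simpa using Cardinal.ord_strictMono hκ.1.aleph0_lt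
  obtain ⟨Φ, hΦ⟩ := (Def.exTup (R := fun M (_ : Fin 1 → ZFSet.{u}) (T : Fin 6 → ZFSet.{u}) r =>
    ∃ t s, r = pair t s ∧ R M T t s) 0
      fun _ T r => .exPair r (hR (fun k => some (some (T k))) (some none) none)).exists_sigma12
  -- Unpacking the tuple recovers its entries, as tuples and pairs are injective.
  have hdec : ∀ M, (∃ T r, tup codeTable (pair t s) = tup T r ∧ ∃ t s, r = pair t s ∧ R M T t s) ↔
      R M codeTable t s := by
    intro M
    constructor
    · rintro ⟨T, _, h, t', s', rfl, H⟩
      rw [tup_inj, pair_inj] at h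
      rwa [h.1, h.2.1, h.2.2]
    · exact fun H => ⟨_, _, rfl, _, _, rfl, H⟩
  have hmem : tup codeTable (pair t s) ∈ VSet κ.ord :=
    (tup_mem_level hlim).2 ⟨codeTable_mem_level hω, (opair_mem_level hlim).2 ⟨ht, hs⟩⟩
  obtain ⟨ξ, hξ, hmem', h'⟩ := hκ.2 Φ _ hmem ((hΦ _ _ _).2 ⟨hlim, X, fun Y => (hdec _).2 (h Y)⟩)
  obtain ⟨hξl, X', hX'⟩ := (hΦ _ _ _).1 h'
  have := (opair_mem_level hξl).1 ((tup_mem_level hξl).1 hmem').2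
  exact ⟨ξ, hξ, this.1, this.2, hξl, X', fun Y => (hdec _).1 (hX' Y)⟩

theorem definesIn_iff {κ : Cardinal.{u}} (hκ : κ.IsInaccessible) {C : Set (Set.Iio κ.ord)} {m : ℕ}
    {φ : LSet.Formula (Fin (m + 1))} : (∃ p, DefinesIn κ C φ p) ↔
      ∃ p : Fin m → VSet κ.ord, ∀ x : VSet κ.ord, Sat (VSet κ.ord) φ (Fin.cons x p) ↔
        ∃ ξ ∈ C, (x : ZFSet.{u}) = (ξ : Ordinal.{u}).toZFSet := by
  rw [← hSet_eq_vSet hκ]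
  rfl

/-- Only the unboundedness of the solution set is reflected; that `ξ` belongs to `C` then follows
from closedness of `C` in `κ`. -/
theorem IsSigma12Indescribable.isSigmaMahlo {κ : Cardinal.{u}} (hκ : IsSigma12Indescribable κ) :
    IsSigmaMahlo 2 κ := by
  refine ⟨hκ.1, fun C hC ⟨m, φ, p, hφ, hdef⟩ => ?_⟩
  have hlim := Cardinal.isSuccLimit_ord hκ.1.aleph0_lt.le
  have hω : ω < κ.ord := by simpa using Cardinal.ord_strictMono hκ.1.aleph0_lt
  obtain ⟨p, hp⟩ := (definesIn_iff hκ.1).1 ⟨p, hdef⟩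
  have h0 : ∅ ∈ V_ κ.ord := by simpa [mem_vonNeumann] using hlim.bot_lt
  -- The value `∅` of variable `0` is a dummy; candidates overwrite it.
  obtain ⟨s, hs, hsv⟩ := exists_values_eq hlim hω
    (Fin.cons ∅ fun i => (p i : ZFSet.{u}) : Fin (m + 1) → ZFSet.{u})
    (Fin.cases h0 fun i => (p i).2)
  have hsp : ∀ i : Fin m, values s (i + 1) = p i := fun i => by simpa using hsv i.succ
  have hsat := isSatClass_trueSat hlim hω (fun _ => False) (fun _ => False)
  have hsol : ∀ b ∈ V_ κ.ord, InSol (· ∈ V_ κ.ord) (trueSat (· ∈ V_ κ.ord) (fun _ => False)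
      fun _ => False) (NFormula.ofSet φ).code s b ↔
      ∃ ξ ∈ C, b = (ξ : Ordinal.{u}).toZFSet := fun b hb => by
    rw [hsat.inSol_iff hlim hω _ hs hb, eval_ofSet_update φ s ⟨b, hb⟩ p hsp]
    exact hp ⟨b, hb⟩
  obtain ⟨ξ, hξ, -, hsξ, hξl, X, hX⟩ := hκ.reflect
    (R := fun M T t s => UnboundedSentence (· ∈ V_ M.o) M.X M.Y T t s)
    (fun T i j => Def.unboundedSentence T i j) (NFormula.code_mem_level hω (NFormula.ofSet φ)) hs
    fun Y => ⟨hsat, ((isClub_iff hsol).1 hC).2.1, inaccessibleWith_of_isInaccessible hκ.1 Y⟩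
  obtain ⟨μ, hμ, rfl⟩ := exists_isInaccessible fun Y => (hX Y).2.2
  have hωξ : ω < μ.ord := by simpa using Cardinal.ord_strictMono hμ.aleph0_lt
  have hpξ : ∀ i, (p i : ZFSet.{u}) ∈ VSet μ.ord := fun i => hsp i ▸ app_mem_level hsξ _
  have hun : ∀ x ∈ V_ μ.ord, ∃ η ∈ C, (η : Ordinal.{u}) < μ.ord ∧
      ¬ (η : Ordinal.{u}).toZFSet ∈ x := by
    intro x hx
    obtain ⟨b, hb, hbx, hbs⟩ := (hX fun _ => True).2.1 x hx
    rw [(hX fun _ => True).1.inSol_iff hξl hωξ _ hsξ hb,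
      eval_ofSet_update φ s ⟨b, hb⟩ (fun i => ⟨p i, hpξ i⟩) hsp] at hbs
    have hbκ : b ∈ VSet κ.ord := vonNeumann_subset_of_le hξ.le hb
    -- Solutions in `V_ξ` are solutions in `V_κ`, by upward absoluteness of `Σ₂` formulas between
    -- inaccessible levels.
    have hup : Sat (VSet κ.ord) φ (Fin.cons ⟨b, hbκ⟩ p) :=
      LevyClass.bSat_up hμ hκ.1 (Cardinal.ord_lt_ord.1 hξ) hφ _ _ _ _
        (Fin.cases rfl fun _ => rfl) (fun i => i.elim0) hbs
    obtain ⟨η, hη, h⟩ := (hp _).1 hup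
    obtain rfl : b = (η : Ordinal.{u}).toZFSet := h
    exact ⟨η, hη, toZFSet_mem_vonNeumann_iff.1 hb, hbx⟩
  refine ⟨⟨μ.ord, hξ⟩, ?_, μ, hμ, rfl⟩
  refine hC.isLUB_mem (t := {η | η ∈ C ∧ (η : Ordinal.{u}) < μ.ord}) (fun η h => h.1) ?_
    ⟨fun η h => h.2.le, fun δ hδ => ?_⟩
  · obtain ⟨η, h1, h2, -⟩ := hun ∅ (by simpa [mem_vonNeumann] using hξl.bot_lt)
    exact ⟨η, h1, h2⟩
  · by_contra! hlt
    have hlt' : (δ : Ordinal.{u}) < μ.ord := hlt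
    -- An ordinal outside `succ δ` is strictly above `δ`.
    obtain ⟨η, h1, h2, h3⟩ := hun (Order.succ (δ : Ordinal.{u})).toZFSet
      (toZFSet_mem_vonNeumann_iff.2 (hξl.succ_lt hlt'))
    rw [toZFSet_mem_toZFSet_iff, Order.lt_succ_iff, not_le] at h3
    exact h3.not_ge (hδ ⟨h1, h2⟩)

/-- The set of codes of `Σ₂` formulas. -/
noncomputable def sigmaTwoCodes : ZFSet.{u} :=
  range fun x : {x : Σ m : ℕ, LSet.Formula (Fin (m + 1)) // IsSigma 2 x.2} =>
    (NFormula.ofSet x.1.2).code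

theorem mem_sigmaTwoCodes {t : ZFSet.{u}} : t ∈ sigmaTwoCodes ↔
    ∃ (m : ℕ) (φ : LSet.Formula (Fin (m + 1))), IsSigma 2 φ ∧ (NFormula.ofSet φ).code = t := by
  rw [sigmaTwoCodes, mem_range]
  exact ⟨fun ⟨x, h⟩ => ⟨x.1.1, x.1.2, x.2, h⟩, fun ⟨m, φ, h, h'⟩ => ⟨⟨⟨m, φ⟩, h⟩, h'⟩⟩

theorem sigmaTwoCodes_mem_level {o : Ordinal.{u}} (hω : ω < o) : sigmaTwoCodes.{u} ∈ V_ o := by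
  refine mem_vonNeumann.2 (lt_of_le_of_lt ?_ hω)
  rw [← subset_vonNeumann]
  intro t ht
  obtain ⟨m, φ, -, rfl⟩ := mem_sigmaTwoCodes.1 ht
  exact natSet_mem_omega _

/-- `MahloSentence` holds at `κ` by `IsSigma12Indescribable.isSigmaMahlo`, and at a smaller level it
means that the level is `V_μ` with `μ` a `Σ₂`-Mahlo cardinal. -/
theorem IsSigma12Indescribable.isInaccessibleLimitOf {κ : Cardinal.{u}}
    (hκ : IsSigma12Indescribable κ) : IsInaccessibleLimitOf (IsSigmaMahlo 2) κ := by
  refine ⟨hκ.1, fun μ₀ hμ₀ => ?_⟩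
  have hlim := Cardinal.isSuccLimit_ord hκ.1.aleph0_lt.le
  have hω : ω < κ.ord := by simpa using Cardinal.ord_strictMono hκ.1.aleph0_lt
  have hsat := isSatClass_trueSat hlim hω (fun _ => False) (fun _ => False)
  obtain ⟨ξ, hξ, -, hsξ, hξl, X, hX⟩ := hκ.reflect
    (R := fun M T t _ => MahloSentence (· ∈ V_ M.o) M.X M.Y T t)
    (fun T i _ => Def.mahloSentence T i) (sigmaTwoCodes_mem_level hω)
    -- The sentence ignores this parameter; its presence in `V_ξ` makes `ξ` larger than `μ₀`.
    (s := μ₀.ord.toZFSet) (toZFSet_mem_vonNeumann_iff.2 (Cardinal.ord_strictMono hμ₀))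
    fun Y => ⟨hsat, fun t ht s hs hclub => by
      obtain ⟨m, φ, hφ, rfl⟩ := mem_sigmaTwoCodes.1 ht
      let C : Set (Set.Iio κ.ord) := {η | InSol (· ∈ V_ κ.ord) (trueSat (· ∈ V_ κ.ord)
        (fun _ => False) fun _ => False) (NFormula.ofSet φ).code s (η : Ordinal.{u}).toZFSet}
      have hC : ∀ b ∈ V_ κ.ord, InSol (· ∈ V_ κ.ord) (trueSat (· ∈ V_ κ.ord)
          (fun _ => False) fun _ => False) (NFormula.ofSet φ).code s b ↔
          ∃ η ∈ C, b = (η : Ordinal.{u}).toZFSet := by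
        intro b hb
        constructor
        · intro h
          have hbo := (hclub.1 b hb h).toZFSet_rank_eq
          refine ⟨⟨rank b, mem_vonNeumann.1 hb⟩, ?_, hbo.symm⟩
          change InSol _ _ _ _ (rank b).toZFSet
          rwa [hbo]
        · rintro ⟨η, h, rfl⟩
          exact h
      obtain ⟨p, hp⟩ := (definesIn_iff hκ.1 (C := C) (φ := φ)).2
        ⟨fun i => ⟨values s (i + 1), app_mem_level hs _⟩, fun x => by
          rw [← hC x x.2, hsat.inSol_iff hlim hω _ hs x.2]
          exact (eval_ofSet_update φ s x _ fun _ => rfl).symm⟩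
      obtain ⟨η, hη, hinacc⟩ := hκ.isSigmaMahlo.2 C ((isClub_iff hC).2 hclub) ⟨m, φ, p, hφ, hp⟩
      exact ⟨_, toZFSet_mem_vonNeumann_iff.2 η.2, hη, (isInaccOrdIn_iff η.2).2 hinacc⟩,
      inaccessibleWith_of_isInaccessible hκ.1 Y⟩
  obtain ⟨μ, hμ, rfl⟩ := exists_isInaccessible fun Y => (hX Y).2.2
  have hωξ : ω < μ.ord := by simpa using Cardinal.ord_strictMono hμ.aleph0_lt
  refine ⟨μ, Cardinal.ord_lt_ord.1 (toZFSet_mem_vonNeumann_iff.1 hsξ), Cardinal.ord_lt_ord.1 hξ,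
    hμ, fun C hC ⟨m, φ, p, hφ, hdef⟩ => ?_⟩
  obtain ⟨p, hp⟩ := (definesIn_iff hμ).1 ⟨p, hdef⟩
  obtain ⟨s, hs, hsv⟩ := exists_values_eq hξl hωξ
    (Fin.cons ∅ fun i => (p i : ZFSet.{u}) : Fin (m + 1) → ZFSet.{u})
    (Fin.cases (by simpa [mem_vonNeumann] using hξl.bot_lt) fun i => (p i).2)
  have hsp : ∀ i : Fin m, values s (i + 1) = p i := fun i => by simpa using hsv i.succ
  obtain ⟨hsat, hmahlo, -⟩ := hX fun _ => True
  have hsol : ∀ b ∈ V_ μ.ord, InSol (· ∈ V_ μ.ord) X (NFormula.ofSet φ).code s b ↔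
      ∃ ξ ∈ C, b = (ξ : Ordinal.{u}).toZFSet := fun b hb => by
    rw [hsat.inSol_iff hξl hωξ _ hs hb, eval_ofSet_update φ s ⟨b, hb⟩ p hsp]
    exact hp ⟨b, hb⟩
  obtain ⟨b, hb, hbs, hbi⟩ := hmahlo _ (mem_sigmaTwoCodes.2 ⟨m, φ, hφ, rfl⟩) s hs
    ((isClub_iff hsol).1 hC)
  obtain ⟨η, hη, rfl⟩ := (hsol b hb).1 hbs
  exact ⟨η, hη, (isInaccOrdIn_iff η.2).1 hbi⟩

end

/-! ### Part (2): coded `Σ¹₂` truth and the `Π₂` club of reflection points -/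

section

open scoped ZFSet
open ZFSet FirstOrder FirstOrder.Language Ordinal

/-! ### Coded `Σ¹₂` statements -/

/-- `V_a` is a limit level that satisfies the `Σ¹₂` statement coded by `p`. -/
def TrueSigma12 (a : Ordinal.{u}) (p : ZFSet.{u}) : Prop :=
  Order.IsSuccLimit a ∧ ∃ (T : Fin 6 → ZFSet.{u}) (r : ZFSet.{u}), p = tup T r ∧
    ∃ t s, r = pair t s ∧ ∃ X : ZFSet.{u} → Prop, ∀ Y S : ZFSet.{u} → Prop,
      IsSatClass (· ∈ V_ a) S X Y T → S (pair t s)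

/-- The version of `TrueSigma12` in which subsets of the level `A` are members of `D`. -/
def TrueSigma12In (D : ZFSet.{u} → Prop) (A p : ZFSet.{u}) : Prop :=
  IsLimitDom (· ∈ A) ∧ ∃ (T : Fin 6 → ZFSet.{u}) (r : ZFSet.{u}), p = tup T r ∧
    ∃ t s, r = pair t s ∧ ∃ X, D X ∧ ∀ Y, D Y → ∀ S, D S →
      IsSatClass (· ∈ A) (· ∈ S) (· ∈ X) (· ∈ Y) T → pair t s ∈ S

theorem IsSatClass.congr {a : Ordinal.{u}} (ha : Order.IsSuccLimit a)
    {S S' X X' Y Y' : ZFSet.{u} → Prop} {T : Fin 6 → ZFSet.{u}} (hS : ∀ z ∈ V_ a, S z ↔ S' z)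
    (hX : ∀ z ∈ V_ a, X z ↔ X' z) (hY : ∀ z ∈ V_ a, Y z ↔ Y' z)
    (h : IsSatClass (· ∈ V_ a) S X Y T) : IsSatClass (· ∈ V_ a) S' X' Y' T := by
  have hp : ∀ c ∈ V_ a, ∀ s ∈ V_ a, S (pair c s) ↔ S' (pair c s) := fun c hc s hs =>
    hS _ ((opair_mem_level ha).2 ⟨hc, hs⟩)
  constructor
  · intro c hc i hi j hj hT s hs
    rw [← hp c hc s hs, h.eq c hc i hi j hj hT s hs]
  · intro c hc i hi j hj hT s hs
    rw [← hp c hc s hs, h.mem c hc i hi j hj hT s hs]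
  · intro c hc i hi hT s hs
    rw [← hp c hc s hs, h.predX c hc i hi hT s hs]
    exact exists_congr fun b => and_congr_right fun hb => and_congr_right fun _ => hX b hb
  · intro c hc i hi hT s hs
    rw [← hp c hc s hs, h.predY c hc i hi hT s hs]
    exact exists_congr fun b => and_congr_right fun hb => and_congr_right fun _ => hY b hb
  · intro c hc d hd e he hT s hs
    rw [← hp c hc s hs, h.nand c hc d hd e he hT s hs, hp d hd s hs, hp e he s hs]
  · intro c hc n hn d hd hT s hs
    rw [← hp c hc s hs, h.all c hc n hn d hd hT s hs]
    exact forall_congr' fun r => forall_congr' fun hr => forall_congr' fun _ => hp d hd r hr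

/-- Subsets of `V_a` are members of `V_o`, and a class matters only through its trace on `V_a`. -/
theorem trueSigma12In_iff {a o : Ordinal.{u}} (hao : a < o) {p : ZFSet.{u}} (hp : p ∈ V_ a) :
    TrueSigma12In (· ∈ V_ o) (V_ a) p ↔ TrueSigma12 a p := by
  have hlim : IsLimitDom (· ∈ V_ a) ↔ Order.IsSuccLimit a :=
    ⟨fun h => isSuccLimit_of_isLimitDom h ⟨p, hp⟩, isLimitDom_vonNeumann⟩
  have hsep : ∀ P : ZFSet.{u} → Prop, (V_ a).sep P ∈ V_ o := fun P =>
    mem_vonNeumann_of_subset sep_subset (vonNeumann_mem_of_lt hao)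
  have hiff : ∀ P : ZFSet.{u} → Prop, ∀ z ∈ V_ a, P z ↔ z ∈ (V_ a).sep P := fun P z hz => by
    simp [ZFSet.mem_sep, hz]
  rw [TrueSigma12In, TrueSigma12, hlim]
  refine and_congr_right fun ha => exists_congr fun T => exists_congr fun r =>
    and_congr_right fun hpr => exists_congr fun t => exists_congr fun s =>
    and_congr_right fun hr => ?_
  have hts : pair t s ∈ V_ a := hr ▸ ((tup_mem_level ha).1 (hpr ▸ hp)).2
  constructor
  · rintro ⟨X, -, H⟩
    refine ⟨(· ∈ X), fun Y S hS => (hiff S _ hts).2 (H _ (hsep Y) _ (hsep S) ?_)⟩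
    exact hS.congr ha (hiff S) (fun _ _ => Iff.rfl) (hiff Y)
  · rintro ⟨X, H⟩
    refine ⟨_, hsep X, fun Y _ S _ hS => H (· ∈ Y) (· ∈ S) ?_⟩
    exact hS.congr ha (fun _ _ => Iff.rfl) (fun z hz => (hiff X z hz).symm) (fun _ _ => Iff.rfl)

theorem Def.trueSigma12In {α : Type} (i j : α) :
    Def fun M v => TrueSigma12In.{u} (· ∈ V_ M.o) (v i) (v j) :=
  .and (.isLimitDom (.memVar _) (.memVar _)) (.exTup _ fun f T _ => .exPair _ (.ex (.all (.all (.imp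
    (.isSatClass (D := fun _ v x => x ∈ v (some (some (some (some (some (f i)))))))
      (.memVar _) (.memVar _) (.memVar _) (.memVar _) (.memVar _)
      fun k => some (some (some (some (some (T k))))))
    (.pair_mem _ _ _))))))

/-- The set coding the `Σ¹₂` statement with matrix `Φ` and parameter `p`. -/
noncomputable def sigma12Code (Φ : LSetXY.Formula (Fin 1)) (p : ZFSet.{u}) : ZFSet.{u} :=
  tup codeTable (pair (NFormula.ofXY Φ).code {pair ∅ p})

theorem values_singleton (p : ZFSet.{u}) : values {pair ∅ p} 0 = p := by
  ext z
  rw [values, natSet_zero, mem_app]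
  simp

theorem singleton_mem_level {o : Ordinal.{u}} (ho : Order.IsSuccLimit o) {p : ZFSet.{u}}
    (hp : p ∈ V_ o) : {pair ∅ p} ∈ V_ o := by
  have := pair_mem_level ho (x := pair ∅ p) (y := pair ∅ p)
  rw [pair_eq_singleton] at this
  have h := (opair_mem_level ho).2 ⟨(by simpa [mem_vonNeumann] using ho.bot_lt : ∅ ∈ V_ o), hp⟩
  exact this h h

theorem sigma12Code_mem_level {o : Ordinal.{u}} (ho : Order.IsSuccLimit o) (hω : ω < o)
    (Φ : LSetXY.Formula (Fin 1)) {p : ZFSet.{u}} (hp : p ∈ V_ o) : sigma12Code Φ p ∈ V_ o :=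
  (tup_mem_level ho).2 ⟨codeTable_mem_level hω, (opair_mem_level ho).2
    ⟨NFormula.code_mem_level hω _, singleton_mem_level ho hp⟩⟩

/-- The tables have infinite rank, so reflecting a coded statement never leads to a level at or
below `V_ω`, where coded satisfaction would be unreliable. -/
theorem omega0_lt_of_sigma12Code_mem {o : Ordinal.{u}} (ho : Order.IsSuccLimit o)
    {Φ : LSetXY.Formula (Fin 1)} {p : ZFSet.{u}} (h : sigma12Code Φ p ∈ V_ o) :
    ω < o ∧ p ∈ V_ o := by
  obtain ⟨h1, h2⟩ := (tup_mem_level ho).1 h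
  constructor
  · refine lt_of_le_of_lt ?_ (mem_vonNeumann.1 (h1 2))
    rw [omega0_le]
    intro n
    have hmem : pair (NFormula.predX n).code (natSet n) ∈ codeTable.{u} 2 := mem_range.2 ⟨n, rfl⟩
    have h3 : natSet.{u} n ∈ V_ (rank (codeTable.{u} 2)) := by
      refine (isTransitive_vonNeumann _).mem_trans (?_ : _ ∈ {(NFormula.predX n).code, natSet n})
        ((isTransitive_vonNeumann _).mem_trans (?_ : _ ∈ pair (NFormula.predX n).code (natSet n))
          (mem_vonNeumann.2 (rank_lt_of_mem hmem)))
      · exact mem_pair.2 (.inr rfl)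
      · exact mem_pair.2 (.inr rfl)
    rw [natSet, toZFSet_mem_vonNeumann_iff] at h3
    exact h3.le
  · have h3 := (isTransitive_vonNeumann o).mem_trans (mem_singleton.2 rfl)
      ((opair_mem_level ho).1 h2).2
    exact ((opair_mem_level ho).1 h3).2

/-- The satisfaction class is quantified universally together with `Y`, which keeps the statement
`Σ¹₂`; existence and uniqueness on codes make this equivalent to truth. -/
theorem trueSigma12_sigma12Code {a : Ordinal.{u}} (ha : Order.IsSuccLimit a) (hω : ω < a)
    (Φ : LSetXY.Formula (Fin 1)) {p : ZFSet.{u}} (hp : p ∈ VSet a) :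
    TrueSigma12 a (sigma12Code Φ p) ↔ SatSigma12 (VSet a) Φ ⟨p, hp⟩ := by
  have hs := singleton_mem_level ha hp
  have key : ∀ X Y : ZFSet.{u} → Prop, (NFormula.ofXY Φ).Eval (· ∈ V_ a) X Y
      (values {pair ∅ p}) ↔ @Formula.Realize LSetXY (VSet a)
        (memPredStructure (VSet a) {x | X x} {x | Y x}) (Fin 1) Φ (fun _ => ⟨p, hp⟩) := by
    intro X Y
    refine NFormula.eval_ofXY (A := VSet a) Φ (v := fun _ => ⟨p, hp⟩) (xs := default) fun c => ?_
    rcases c with i | j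
    · simpa [NFormula.varNum] using values_singleton p
    · exact j.elim0
  constructor
  · rintro ⟨-, T, _, h, t, s, rfl, X, hX⟩
    rw [sigma12Code, tup_inj, pair_inj] at h
    obtain ⟨rfl, rfl, rfl⟩ := h
    refine ⟨{x | X x}, fun Y => ?_⟩
    let Y' : ZFSet.{u} → Prop := fun z => ∃ hz, (⟨z, hz⟩ : VSet a) ∈ Y
    have := (key X Y').1 (trueSat_pair.1 (hX Y' _ (isSatClass_trueSat ha hω X Y')))
    convert this using 2
    ext x
    exact ⟨fun h => ⟨x.2, h⟩, fun ⟨_, h⟩ => h⟩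
  · rintro ⟨X, hX⟩
    refine ⟨ha, _, _, rfl, _, _, rfl, fun z => ∃ hz, (⟨z, hz⟩ : VSet a) ∈ X, fun Y S hS => ?_⟩
    rw [hS.iff_eval ha hω _ hs, key]
    convert hX {x | Y x} using 2
    ext x
    exact ⟨fun ⟨_, h⟩ => h, fun h => ⟨x.2, h⟩⟩

/-- All true coded `Σ¹₂` statements about `V_a` reflect to a smaller level. -/
def Reflecting (a : Ordinal.{u}) : Prop :=
  ∀ p ∈ V_ a, TrueSigma12 a p → ∃ b < a, p ∈ V_ b ∧ TrueSigma12 b p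

theorem Reflecting.isSigma12Indescribable {κ : Cardinal.{u}} (hκ : κ.IsInaccessible)
    (h : Reflecting κ.ord) : IsSigma12Indescribable κ := by
  refine ⟨hκ, fun Φ p hp H => ?_⟩
  have hlim := Cardinal.isSuccLimit_ord hκ.aleph0_lt.le
  have hω : ω < κ.ord := by simpa using Cardinal.ord_strictMono hκ.aleph0_lt
  obtain ⟨b, hb, hmem, hT⟩ := h _ (sigma12Code_mem_level hlim hω Φ hp)
    ((trueSigma12_sigma12Code hlim hω Φ hp).2 H)
  obtain ⟨hωb, hpb⟩ := omega0_lt_of_sigma12Code_mem hT.1 hmem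
  exact ⟨b, hb, hpb, (trueSigma12_sigma12Code hT.1 hωb Φ hpb).1 hT⟩

/-! ### The club -/

/-- Coded `Σ¹₂` statements with parameters in `V_ξ` that hold in some level below `o` hold in a
level below `ξ`, and all reflecting inaccessible cardinals below `o` are below `ξ`. -/
def IsReflectionPoint (o ξ : Ordinal.{u}) : Prop :=
  (∀ a < o, ∀ p ∈ V_ a, TrueSigma12 a p → (∃ b < ξ, p ∈ V_ b) →
    ∃ c < ξ, p ∈ V_ c ∧ TrueSigma12 c p) ∧
  ∀ a < o, (∃ μ : Cardinal.{u}, μ.IsInaccessible ∧ a = μ.ord) → Reflecting a → a < ξ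

/-- The version of `IsReflectionPoint` for ordinals as sets and levels in `D`. -/
def IsReflectionPointIn (D : ZFSet.{u} → Prop) (x : ZFSet.{u}) : Prop :=
  x.IsOrdinal ∧
  (∀ A, D A → (∃ a, A = V_ a) → ∀ p ∈ A, TrueSigma12In D A p →
    (∃ B, D B ∧ (∃ b, B = V_ b) ∧ p ∈ B ∧ ¬ x ⊆ B) →
    ∃ B, D B ∧ (∃ b, B = V_ b) ∧ p ∈ B ∧ ¬ x ⊆ B ∧ TrueSigma12In D B p) ∧
  ∀ A, D A → (∃ a, A = V_ a) → (∀ Y, D Y → InaccessibleWith (· ∈ A) (· ∈ Y)) →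
    (∀ p ∈ A, TrueSigma12In D A p → ∃ B ∈ A, (∃ b, B = V_ b) ∧ p ∈ B ∧ TrueSigma12In D B p) →
    ¬ x ⊆ A

theorem Def.isReflectionPointIn {α : Type} (i : α) :
    Def fun M v => IsReflectionPointIn.{u} (· ∈ V_ M.o) (v i) := by
  refine .and (.isOrdinal _) (.and ?_ ?_)
  · exact .all (.imp (.isLevel _) (.ball _ (.imp (.trueSigma12In _ _) (.imp
      (.ex (.and (.isLevel _) (.and (.mem _ _) (.not (.subset _ _)))))
      (.ex (.and (.isLevel _) (.and (.mem _ _) (.and (.not (.subset _ _))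
        (.trueSigma12In _ _)))))))))
  · exact .all (.imp (.isLevel _) (.imp
      (.all (.inaccessibleWith (.memVar _) (.memVar _) (.memVar _))) (.imp
      (.ball _ (.imp (.trueSigma12In _ _) (.bex _ (.and (.isLevel _) (.and (.mem _ _)
        (.trueSigma12In _ _)))))) (.not (.subset _ _)))))

/-- An ordinal `b` is represented by `V_b`, and `b < ξ` by `¬ ξ ⊆ V_b`. -/
theorem isReflectionPointIn_iff {o ξ : Ordinal.{u}} (hξ : ξ < o) :
    IsReflectionPointIn (· ∈ V_ o) ξ.toZFSet ↔ IsReflectionPoint o ξ := by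
  have hV : ∀ {a}, V_ a ∈ V_ o ↔ a < o := vonNeumann_mem_vonNeumann_iff
  constructor
  · rintro ⟨-, h1, h2⟩
    refine ⟨fun a ha p hp hT ⟨b, hb, hpb⟩ => ?_, fun a ha hi hr => ?_⟩
    · obtain ⟨_, hc, ⟨c, rfl⟩, hpc, hξc, hTc⟩ := h1 _ (hV.2 ha) ⟨a, rfl⟩ p hp
        ((trueSigma12In_iff ha hp).2 hT) ⟨_, hV.2 (hb.trans hξ), ⟨b, rfl⟩, hpb, by
          rwa [toZFSet_subset_vonNeumann_iff, not_le]⟩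
      rw [toZFSet_subset_vonNeumann_iff, not_le] at hξc
      exact ⟨c, hξc, hpc, (trueSigma12In_iff (hV.1 hc) hpc).1 hTc⟩
    · have := h2 _ (hV.2 ha) ⟨a, rfl⟩
        ((forall_mem_inaccessibleWith_iff ha).2 (forall_inaccessibleWith_iff.2 hi))
        fun p hp hT => by
          obtain ⟨b, hb, hpb, hTb⟩ := hr p hp ((trueSigma12In_iff ha hp).1 hT)
          exact ⟨_, vonNeumann_mem_of_lt hb, ⟨b, rfl⟩, hpb,
            (trueSigma12In_iff (hb.trans ha) hpb).2 hTb⟩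
      rwa [toZFSet_subset_vonNeumann_iff, not_le] at this
  · rintro ⟨h1, h2⟩
    refine ⟨isOrdinal_toZFSet _, ?_, ?_⟩
    · rintro _ ha ⟨a, rfl⟩ p hp hT ⟨_, hb, ⟨b, rfl⟩, hpb, hξb⟩
      rw [toZFSet_subset_vonNeumann_iff, not_le] at hξb
      obtain ⟨c, hc, hpc, hTc⟩ := h1 a (hV.1 ha) p hp
        ((trueSigma12In_iff (hV.1 ha) hp).1 hT) ⟨b, hξb, hpb⟩
      exact ⟨_, hV.2 (hc.trans hξ), ⟨c, rfl⟩, hpc, by rwa [toZFSet_subset_vonNeumann_iff, not_le],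
        (trueSigma12In_iff (hc.trans hξ) hpc).2 hTc⟩
    · rintro _ ha ⟨a, rfl⟩ hi hr
      rw [toZFSet_subset_vonNeumann_iff, not_le]
      refine h2 a (hV.1 ha) (forall_inaccessibleWith_iff.1
        ((forall_mem_inaccessibleWith_iff (hV.1 ha)).1 hi)) fun p hp hT => ?_
      obtain ⟨_, hb, ⟨b, rfl⟩, hpb, hTb⟩ := hr p hp ((trueSigma12In_iff (hV.1 ha) hp).2 hT)
      have hba := vonNeumann_mem_vonNeumann_iff.1 hb
      exact ⟨b, hba, hpb, (trueSigma12In_iff (hba.trans (hV.1 ha)) hpb).1 hTb⟩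

theorem _root_.Cardinal.IsInaccessible.exists_isSuccLimit_lt {κ : Cardinal.{u}}
    (hκ : κ.IsInaccessible) {a : Ordinal.{u}} (ha : a < κ.ord) :
    ∃ o < κ.ord, Order.IsSuccLimit o ∧ a < o := by
  have hω : ω < κ.ord := by simpa using Cardinal.ord_strictMono hκ.aleph0_lt
  exact ⟨a + ω, Ordinal.isPrincipal_add_ord hκ.aleph0_lt.le ha hω,
    Ordinal.isSuccLimit_add _ Ordinal.isSuccLimit_omega0,
    lt_add_of_pos_right _ Ordinal.omega0_pos⟩

/-- Each instance of the two clauses concerns a single `a < κ`, so it is visible at any limit `o`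
above `a` and `ξ`. -/
theorem isReflectionPoint_iff_forall {κ : Cardinal.{u}} (hκ : κ.IsInaccessible) {ξ : Ordinal.{u}}
    (hξ : ξ < κ.ord) : IsReflectionPoint κ.ord ξ ↔
      ∀ o < κ.ord, Order.IsSuccLimit o → ξ < o → IsReflectionPoint o ξ := by
  constructor
  · exact fun h o ho _ _ => ⟨fun a ha => h.1 a (ha.trans ho), fun a ha => h.2 a (ha.trans ho)⟩
  · intro h
    have hex : ∀ a < κ.ord, ∃ o < κ.ord, Order.IsSuccLimit o ∧ a < o ∧ ξ < o := fun a ha => by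
      obtain ⟨o, ho, hlt, hm⟩ := hκ.exists_isSuccLimit_lt (max_lt ha hξ)
      exact ⟨o, ho, hlt, (le_max_left _ _).trans_lt hm, (le_max_right _ _).trans_lt hm⟩
    refine ⟨fun a ha => ?_, fun a ha => ?_⟩
    · obtain ⟨o, ho, hl, hao, hξo⟩ := hex a ha
      exact (h o ho hl hξo).1 a hao
    · obtain ⟨o, ho, hl, hao, hξo⟩ := hex a ha
      exact (h o ho hl hξo).2 a hao

/-- The hypothesis `h` serves only unboundedness: without a bound on the reflecting inaccessibles
the second clause could fail everywhere. -/
theorem isClub_isReflectionPoint {κ μ₀ : Cardinal.{u}} (hκ : κ.IsInaccessible) (hμ₀ : μ₀ < κ)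
    (h : ∀ ν, μ₀ < ν → ν < κ → ¬ IsSigma12Indescribable ν) :
    IsClub {ξ : Set.Iio κ.ord | IsReflectionPoint κ.ord ξ} := by
  have hlim := Cardinal.isSuccLimit_ord hκ.aleph0_lt.le
  refine ⟨fun d hd hne _ a ha => ⟨fun b hb p hp hT ⟨c, hc, hpc⟩ => ?_, fun b hb hi hr => ?_⟩,
    fun a => ?_⟩
  · obtain ⟨η, hη, hcη⟩ : ∃ η ∈ d, c < η.1 := by
      by_contra! hn
      have : a ≤ ⟨c, hc.trans a.2⟩ := ha.2 fun η hη => hn η hη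
      exact hc.not_ge this
    obtain ⟨e, he, h'⟩ := (hd hη).1 b hb p hp hT ⟨c, hcη, hpc⟩
    exact ⟨e, he.trans_le (ha.1 hη), h'⟩
  · obtain ⟨η, hη⟩ := hne
    exact ((hd hη).2 b hb hi hr).trans_le (ha.1 hη)
  · have hF : ∀ b : Set.Iio κ.ord, ∃ c : Set.Iio κ.ord, ∀ p ∈ V_ b.1,
        (∃ e < κ.ord, p ∈ V_ e ∧ TrueSigma12 e p) → ∃ e < c.1, p ∈ V_ e ∧ TrueSigma12 e p := by
      classical
      intro b
      let g : ZFSet.{u} → Ordinal.{u} := fun p =>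
        if h : ∃ e < κ.ord, p ∈ V_ e ∧ TrueSigma12 e p then h.choose else 0
      obtain ⟨c, hc, hbd⟩ := exists_bound_of_card_lt hκ
        (card_lt_of_mem_vonNeumann hκ (vonNeumann_mem_of_lt b.2)) g fun p _ => by
          by_cases h : ∃ e < κ.ord, p ∈ V_ e ∧ TrueSigma12 e p
          · simp only [g, dif_pos h]
            exact h.choose_spec.1
          · simp only [g, dif_neg h]
            exact hlim.bot_lt
      refine ⟨⟨c, hc⟩, fun p hp h => ?_⟩
      have := hbd p hp
      simp only [g, dif_pos h] at this
      exact ⟨_, this, h.choose_spec.2⟩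
    choose F hF using hF
    -- Iterate `F` from a point above both `a` and `μ₀`; the supremum stays below `κ`, whose
    -- cofinality is uncountable.
    let f : ℕ → Set.Iio κ.ord := fun n => Nat.rec
      ⟨max a.1 (Order.succ μ₀.ord), max_lt a.2 (hlim.succ_lt (Cardinal.ord_strictMono hμ₀))⟩
      (fun _ b => F b) n
    have hlt : ⨆ n, (f n).1 < κ.ord := by
      refine lift_iSup_lt_of_lt_cof ?_ fun n => (f n).2
      simpa [hκ.isRegular.cof_ord] using hκ.aleph0_lt
    have hle : ∀ n, (f n).1 ≤ ⨆ n, (f n).1 := Ordinal.le_iSup _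
    refine ⟨⟨_, hlt⟩, ⟨fun b hb p hp hT ⟨c, hc, hpc⟩ => ?_, fun b hb hi hr => ?_⟩,
      (le_max_left a.1 _).trans (hle 0)⟩
    · obtain ⟨n, hn⟩ := Ordinal.lt_iSup_iff.1 hc
      obtain ⟨e, he, h'⟩ := hF (f n) p (vonNeumann_subset_of_le hn.le hpc) ⟨b, hb, hp, hT⟩
      exact ⟨e, he.trans_le (hle (n + 1)), h'⟩
    · obtain ⟨ν, hν, rfl⟩ := hi
      have hνμ : ν ≤ μ₀ := by
        by_contra! hn
        exact h ν hn (Cardinal.ord_lt_ord.1 hb) (hr.isSigma12Indescribable hν)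
      exact (Order.lt_succ_of_le (Cardinal.ord_le_ord.2 hνμ)).trans_le
        ((le_max_right a.1 _).trans (hle 0))

/-! ### `Δ₀` formulas -/

/-- Makes room for a further bound variable. -/
def liftVar {β : Type} {m : ℕ} : β ⊕ Fin m → β ⊕ Fin (m + 1) := Sum.map id Fin.castSucc

theorem sumElim_snoc_liftVar {β : Type} {γ : Type*} {m : ℕ} (v : β → γ) (xs : Fin m → γ) (a : γ)
    (c : β ⊕ Fin m) : Sum.elim v (Fin.snoc xs a : Fin (m + 1) → γ) (liftVar c) = Sum.elim v xs c := by
  rcases c with i | j <;> simp [liftVar]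

/-- The relativization of a formula to the value of the variable `W`, where `X` and `Y` are
interpreted as empty. -/
def toDelta0 {α β : Type} : ∀ {k : ℕ}, LSetXY.BoundedFormula α k → ∀ {m : ℕ}, β ⊕ Fin m →
    (α ⊕ Fin k → β ⊕ Fin m) → LSet.BoundedFormula β m
  | _, .falsum, _, _, _ => .falsum
  | _, .equal t₁ t₂, _, _, ρ => .equal (.var (ρ (termVar t₁))) (.var (ρ (termVar t₂)))
  | _, .rel MemPredRel.mem ts, _, _, ρ => Relations.boundedFormula₂ (L := LSet) MemRel.mem
      (.var (ρ (termVar (ts 0)))) (.var (ρ (termVar (ts 1))))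
  | _, .rel MemPredRel.predX _, _, _, _ => .falsum
  | _, .rel MemPredRel.predY _, _, _, _ => .falsum
  | _, .imp φ ψ, _, W, ρ => (toDelta0 φ W ρ).imp (toDelta0 ψ W ρ)
  | _, .all φ, m, W, ρ => boundedAll (.var W) (toDelta0 φ (liftVar W) (Sum.elim
      (fun i => liftVar (ρ (.inl i))) (Fin.snoc (α := fun _ => β ⊕ Fin (m + 1))
        (fun j => liftVar (ρ (.inr j))) (.inr (Fin.last m)))))

theorem isDelta0_toDelta0 {α β : Type} {k m : ℕ} (φ : LSetXY.BoundedFormula α k) (W : β ⊕ Fin m)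
    (ρ : α ⊕ Fin k → β ⊕ Fin m) : IsDelta0 (toDelta0 φ W ρ) := by
  induction φ generalizing m with
  | falsum => exact .falsum
  | equal t₁ t₂ => exact .atomic (.equal _ _)
  | rel R ts =>
    cases R
    · exact .atomic (.rel _ _)
    · exact .falsum
    · exact .falsum
  | imp φ ψ ihφ ihψ => exact .imp (ihφ _ _) (ihψ _ _)
  | all φ ih => exact .ball _ (ih _ _)

theorem bSat_mem {A : Set ZFSet.{u}} {β : Type} {m : ℕ} {v : β → A} {xs : Fin m → A}
    (c d : β ⊕ Fin m) : BSat A (Relations.boundedFormula₂ (L := LSet) MemRel.mem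
      (.var c) (.var d)) v xs ↔ (Sum.elim v xs c : A).1 ∈ (Sum.elim v xs d : A).1 := by
  let := memStructure A
  exact BoundedFormula.realize_rel₂ (L := LSet)

/-- Quantifiers bounded by the value `V_o` of `W` range exactly over `V_o`, since `A` is transitive.
-/
theorem bSat_toDelta0 {A : Set ZFSet.{u}} (hA : TransClass A) {o : Ordinal.{u}} {α β : Type}
    {k m : ℕ} (φ : LSetXY.BoundedFormula α k) {W : β ⊕ Fin m} {ρ : α ⊕ Fin k → β ⊕ Fin m}
    {v : β → A} {xs : Fin m → A} {v₀ : α → VSet o} {ys : Fin k → VSet o}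
    (hW : (Sum.elim v xs W : A).1 = V_ o)
    (hρ : ∀ c, (Sum.elim v xs (ρ c) : A).1 = (Sum.elim v₀ ys c : VSet o)) :
    BSat A (toDelta0 φ W ρ) v xs ↔ @BoundedFormula.Realize LSetXY (VSet o)
      (memPredStructure (VSet o) {_x | False} {_x | False}) α k φ v₀ ys := by
  let := memPredStructure (VSet o) {_x | False} {_x | False}
  induction φ generalizing m with
  | falsum => exact Iff.rfl
  | equal t₁ t₂ =>
    let := memStructure A
    simp only [toDelta0, BSat, BoundedFormula.Realize, realize_eq_termVar, termVar]
    rw [← Subtype.val_inj, hρ, hρ, Subtype.val_inj]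
  | rel R ts =>
    cases R
    · simp only [toDelta0, bSat_mem, hρ, BoundedFormula.Realize, realize_eq_termVar]
      rfl
    · exact Iff.rfl
    · exact Iff.rfl
  | imp φ ψ ihφ ihψ => exact imp_congr (ihφ hW hρ) (ihψ hW hρ)
  | all φ ih =>
    rw [toDelta0, bSat_boundedAll, termVar, hW]
    have key (a : A) (b : VSet o) (hab : (a : ZFSet) = b) :=
      ih (xs := Fin.snoc xs a) (ys := Fin.snoc ys b) (W := liftVar W) (ρ := Sum.elim
        (fun i => liftVar (ρ (.inl i))) (Fin.snoc (α := fun _ => β ⊕ Fin (m + 1))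
        (fun j => liftVar (ρ (.inr j))) (.inr (Fin.last m))))
        (by rw [sumElim_snoc_liftVar, hW]) fun c => by
          rcases c with i | j
          · simp only [Sum.elim_inl, sumElim_snoc_liftVar]
            exact hρ _
          · refine Fin.lastCases ?_ (fun j => ?_) j
            · simpa using hab
            · simp only [Sum.elim_inr, Fin.snoc_castSucc, sumElim_snoc_liftVar]
              exact hρ _
    constructor
    · intro h b
      have hb : (b : ZFSet) ∈ A := hA _ (Sum.elim v xs W : A).2 _ (hW ▸ b.2)
      exact (key ⟨b, hb⟩ b rfl).1 (h _ b.2)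
    · exact fun h a ha => (key a ⟨a, ha⟩ rfl).2 (h _)

/-- The relation `R` is defined by a `Δ₀` formula in all transitive classes. -/
def Delta0Def {β : Type} {n : ℕ} (R : (β ⊕ Fin n → ZFSet.{u}) → Prop) : Prop :=
  ∃ θ : LSet.BoundedFormula β n, IsDelta0 θ ∧ ∀ A : Set ZFSet.{u}, TransClass A →
    ∀ (v : β → A) (xs : Fin n → A), BSat A θ v xs ↔ R fun c => (Sum.elim v xs c : A)

namespace Delta0Def

variable {β : Type} {n : ℕ} {R R' : (β ⊕ Fin n → ZFSet.{u}) → Prop}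

theorem mem (c d : β ⊕ Fin n) : Delta0Def fun w : β ⊕ Fin n → ZFSet.{u} => w c ∈ w d :=
  ⟨_, .atomic (.rel _ _), fun _ _ _ _ => bSat_mem c d⟩

theorem imp (h : Delta0Def R) (h' : Delta0Def R') : Delta0Def fun w => R w → R' w := by
  obtain ⟨φ, hφ, hφ'⟩ := h
  obtain ⟨ψ, hψ, hψ'⟩ := h'
  exact ⟨φ.imp ψ, hφ.imp hψ, fun A hA v xs => imp_congr (hφ' A hA v xs) (hψ' A hA v xs)⟩

theorem not (h : Delta0Def R) : Delta0Def fun w => ¬ R w :=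
  h.imp ⟨.falsum, .falsum, fun _ _ _ _ => Iff.rfl⟩

theorem ball (c : β ⊕ Fin n) {R : (β ⊕ Fin n → ZFSet.{u}) → ZFSet.{u} → Prop}
    (h : Delta0Def (n := n + 1) fun w => R (fun c => w (liftVar c)) (w (.inr (Fin.last n)))) :
    Delta0Def fun w => ∀ x ∈ w c, R w x := by
  obtain ⟨φ, hφ, hφ'⟩ := h
  refine ⟨boundedAll (.var c) φ, hφ.ball _, fun A hA v xs => ?_⟩
  rw [bSat_boundedAll]
  have key : ∀ a : A, BSat A φ v (Fin.snoc xs a) ↔ R (fun c => (Sum.elim v xs c : A)) a :=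
    fun a => by simp [hφ' A hA, sumElim_snoc_liftVar]
  simp only [key, termVar]
  exact ⟨fun H x hx => H ⟨x, hA _ (Sum.elim v xs c : A).2 _ hx⟩ hx, fun H a ha => H a ha⟩

end Delta0Def

/-- If this holds for all `x`, then `W` is a limit level that contains `ξ`. -/
def IsLevelAt (ξ W H x : ZFSet.{u}) : Prop :=
  ¬ (W ∈ H → (∀ w ∈ H, ∀ y ∈ w, ¬ ∀ u ∈ H, u ∈ w → ¬ ∀ t ∈ y, t ∈ u) →
    (∀ w ∈ H, ∀ u ∈ H, u ∈ w → (∀ t ∈ x, t ∈ u) → x ∈ w) → ξ ∈ W →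
    ¬ ∀ y ∈ W, ¬ ∀ z ∈ W, ¬ y ∈ z)

/-- `IsLevelAt` is a conjunction spelled with implication, negation and bounded `∀`, the connectives
treated in `Delta0Def`. -/
theorem delta0Def_isLevelAt {β : Type} {n : ℕ} (ξ W H x : β ⊕ Fin n) :
    Delta0Def fun w : β ⊕ Fin n → ZFSet.{u} => IsLevelAt (w ξ) (w W) (w H) (w x) :=
  .not (.imp (.mem _ _) (.imp
    (.ball _ (.ball _ (.not (.ball _ (.imp (.mem _ _) (.not (.ball _ (.mem _ _))))))))
    (.imp (.ball _ (.ball _ (.imp (.mem _ _) (.imp (.ball _ (.mem _ _)) (.mem _ _)))))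
    (.imp (.mem _ _) (.not (.ball _ (.not (.ball _ (.not (.mem _ _))))))))))

/-- `H` is a history containing `W`. Only the requirement that all subsets `x` of a `u ∈ w` belong
to `w` needs an unbounded `x`. -/
theorem forall_isLevelAt_iff {o : Ordinal.{u}} (ho : Order.IsSuccLimit o) {ξ W : ZFSet.{u}}
    (hW : W ∈ V_ o) : (∃ H ∈ V_ o, ∀ x ∈ V_ o, IsLevelAt ξ W H x) ↔
      ∃ a, Order.IsSuccLimit a ∧ W = V_ a ∧ ξ ∈ V_ a := by
  constructor
  · rintro ⟨H, hH, h⟩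
    have h' : ∀ x ∈ V_ o, _ := fun x hx => by
      have := h x hx
      rw [IsLevelAt] at this
      push Not at this
      exact this
    obtain ⟨hWH, h1, -, hξ, hlim⟩ := h' ∅ (by simpa [mem_vonNeumann] using ho.bot_lt)
    have hist : IsHistory H := by
      intro w hw x
      have hwo := (isTransitive_vonNeumann o).mem_trans hw hH
      constructor
      · intro hx
        obtain ⟨u, hu, huw, hxu⟩ := h1 w hw x hx
        exact ⟨u, hu, huw, hxu⟩
      · rintro ⟨u, hu, huw, hxu⟩
        have huo := (isTransitive_vonNeumann o).mem_trans hu hH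
        exact (h' x (mem_vonNeumann_of_subset hxu huo)).2.2.1 w hw u hu huw hxu
    rw [hist.eq_vonNeumann hWH] at hξ hlim
    exact ⟨_, isSuccLimit_of_isLimitDom (fun y hy => hlim y hy) ⟨ξ, hξ⟩,
      hist.eq_vonNeumann hWH, hξ⟩
  · rintro ⟨a, ha, rfl, hξ⟩
    refine ⟨levels a, levels_mem_level ho (vonNeumann_mem_vonNeumann_iff.1 hW), fun x _ => ?_⟩
    rw [IsLevelAt]
    push Not
    refine ⟨mem_levels.2 ⟨a, le_rfl, rfl⟩, fun w hw y hy => ?_, fun w hw u hu huw hxu => ?_, hξ,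
      fun y hy => isLimitDom_vonNeumann ha y hy⟩
    · obtain ⟨u, hu, huw, hyu⟩ := (isHistory_levels a w hw y).1 hy
      exact ⟨u, hu, huw, fun t ht => hyu ht⟩
    · exact (isHistory_levels a w hw x).2 ⟨u, hu, huw, fun t ht => hxu t ht⟩

/-- The reflection points of an inaccessible cardinal form a `Π₂` class. -/
theorem exists_isPi_isReflectionPoint : ∃ φ : LSet.Formula (Fin 1), IsPi 2 φ ∧
    ∀ κ : Cardinal.{u}, κ.IsInaccessible → ∀ v : Fin 1 → VSet κ.ord, Sat (VSet κ.ord) φ v ↔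
      ∃ ξ < κ.ord, IsReflectionPoint κ.ord ξ ∧ (v 0 : ZFSet.{u}) = ξ.toZFSet := by
  obtain ⟨θ, hθ, hθ'⟩ := delta0Def_isLevelAt.{u} (β := Fin 1) (n := 3) (.inl 0) (.inr 0) (.inr 1)
    (.inr 2)
  obtain ⟨ψ, hψ⟩ := Def.isReflectionPointIn.{u} (0 : Fin 1)
  let ψ' : LSet.BoundedFormula (Fin 1) 3 :=
    toDelta0 ψ (.inr 0) (Sum.elim Sum.inl Fin.elim0)
  -- "For all `W` and `H`, if `∀ x, θ` then `ψ'`": as `ψ'` does not involve `x`, the universal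
  -- quantifier leaves the hypothesis as `∃ x`, which gives the `Π₂` prefix.
  refine ⟨(θ.imp ψ').ex.all.all, .all (.all (.base (.ex (.base
    (hθ.imp (isDelta0_toDelta0 _ _ _)))))), fun κ hκ v => ?_⟩
  have hlim := Cardinal.isSuccLimit_ord hκ.aleph0_lt.le
  have hψ' : ∀ a, Order.IsSuccLimit a → (v 0 : ZFSet.{u}) ∈ V_ a →
      ∀ xs : Fin 3 → VSet κ.ord, (xs 0 : ZFSet.{u}) = V_ a →
      (BSat (VSet κ.ord) ψ' v xs ↔ IsReflectionPointIn (· ∈ V_ a) (v 0)) := by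
    intro a ha hva xs hxs
    let v₀ : Fin 1 → VSet a := fun _ => ⟨v 0, hva⟩
    refine (bSat_toDelta0 (W := .inr 0) (v := v) (xs := xs) (transClass_vSet _) ψ (v₀ := v₀)
      (ys := default) hxs fun c => ?_).trans
      (hψ ⟨a, fun _ => False, fun _ => False⟩ ha v₀)
    rcases c with i | j
    · rw [Subsingleton.elim i 0]
      rfl
    · exact j.elim0
  have hsat : Sat (VSet κ.ord) (θ.imp ψ').ex.all.all v ↔
      ∀ a < κ.ord, Order.IsSuccLimit a → (v 0 : ZFSet.{u}) ∈ V_ a →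
        IsReflectionPointIn (· ∈ V_ a) (v 0) := by
    have h1 : Sat (VSet κ.ord) (θ.imp ψ').ex.all.all v ↔ ∀ W H : VSet κ.ord, ∃ x : VSet κ.ord,
        IsLevelAt (v 0) W H x → BSat (VSet κ.ord) ψ' v
          (Fin.snoc (Fin.snoc (Fin.snoc default W) H) x) :=
      forall_congr' fun W => forall_congr' fun H => bSat_ex.trans <| exists_congr fun x =>
        imp_congr (hθ' _ (transClass_vSet _) _ _) Iff.rfl
    rw [h1]
    constructor
    · intro h a ha hal hva
      obtain ⟨H, hH, hx⟩ := (forall_isLevelAt_iff hlim (vonNeumann_mem_of_lt ha)).2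
        ⟨a, hal, rfl, hva⟩
      obtain ⟨x, hx'⟩ := h ⟨V_ a, vonNeumann_mem_of_lt ha⟩ ⟨H, hH⟩
      exact (hψ' a hal hva _ rfl).1 (hx' (hx x x.2))
    · intro h W H
      by_contra! hn
      obtain ⟨a, ha, hW, hva⟩ := (forall_isLevelAt_iff hlim W.2).1
        ⟨H, H.2, fun x hx => (hn ⟨x, hx⟩).1⟩
      exact (hn H).2 ((hψ' a ha hva _ hW).2
        (h a (vonNeumann_mem_vonNeumann_iff.1 (hW ▸ W.2)) ha hva))
  rw [hsat]
  constructor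
  · intro h
    obtain ⟨o, ho, hl, hvo⟩ := hκ.exists_isSuccLimit_lt (mem_vonNeumann.1 (v 0).2)
    have hord := (h o ho hl (mem_vonNeumann.2 hvo)).1.toZFSet_rank_eq
    refine ⟨rank (v 0 : ZFSet.{u}), mem_vonNeumann.1 (v 0).2, ?_, hord.symm⟩
    rw [isReflectionPoint_iff_forall hκ (mem_vonNeumann.1 (v 0).2)]
    intro a ha hal hva
    rw [← isReflectionPointIn_iff hva, hord]
    exact h a ha hal (mem_vonNeumann.2 hva)
  · rintro ⟨ξ, hξ, h, hv⟩ a ha hal hva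
    rw [hv] at hva ⊢
    have hξa := toZFSet_mem_vonNeumann_iff.1 hva
    exact (isReflectionPointIn_iff hξa).2 ((isReflectionPoint_iff_forall hκ hξ).1 h a ha hal hξa)

theorem IsLightfacePiMahlo.isInaccessibleLimitOf {κ : Cardinal.{u}} (hκ : IsLightfacePiMahlo 2 κ) :
    IsInaccessibleLimitOf IsSigma12Indescribable κ := by
  refine ⟨hκ.1, fun μ₀ hμ₀ => ?_⟩
  by_contra! hn
  obtain ⟨φ, hφ, hφ'⟩ := exists_isPi_isReflectionPoint.{u}
  let C : Set (Set.Iio κ.ord) := {ξ | IsReflectionPoint κ.ord ξ}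
  obtain ⟨p, hp⟩ := (definesIn_iff hκ.1 (C := C) (m := 0) (φ := φ)).2 ⟨Fin.elim0, fun x => by
    rw [hφ' κ hκ.1]
    exact ⟨fun ⟨ξ, hξ, h, hx⟩ => ⟨⟨ξ, hξ⟩, h, hx⟩, fun ⟨ξ, h, hx⟩ => ⟨ξ, ξ.2, h, hx⟩⟩⟩
  obtain ⟨ξ, hξC, μ, hμ, hξ⟩ := hκ.2 C (isClub_isReflectionPoint hκ.1 hμ₀ hn)
    ⟨φ, hφ, Subsingleton.elim p Fin.elim0 ▸ hp⟩
  -- The first clause at `a = ξ` shows that `ξ` is reflecting; the second then places `ξ` below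
  -- itself. Since `ξ` is a limit, each `q ∈ V_ξ` lies in an earlier level, as the first clause
  -- demands.
  refine (hξC.2 ξ ξ.2 ⟨μ, hμ, hξ⟩ fun q hq hT => hξC.1 ξ ξ.2 q hq hT ?_).false
  rw [hξ, mem_vonNeumann] at hq
  rw [hξ]
  exact ⟨_, (Cardinal.isSuccLimit_ord hμ.aleph0_lt.le).succ_lt hq,
    mem_vonNeumann.2 (Order.lt_succ _)⟩

end

end SetModel

theorem fact3p5 :
    (∀ κ : Cardinal.{u}, SetModel.IsSigma12Indescribable κ →
      SetModel.IsSigmaMahlo 2 κ ∧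
        SetModel.IsInaccessibleLimitOf (SetModel.IsSigmaMahlo 2) κ) ∧
    (∀ κ : Cardinal.{u}, SetModel.IsLightfacePiMahlo 2 κ →
      SetModel.IsInaccessibleLimitOf SetModel.IsSigma12Indescribable κ) :=
  ⟨fun _ hκ => ⟨hκ.isSigmaMahlo, hκ.isInaccessibleLimitOf⟩, fun _ hκ => hκ.isInaccessibleLimitOf⟩
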